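/- Let $X_1,X_2,\dots$ be iid real random variables with cdf $F$, let $F_n(x)=\frac1n\sum_{i=1}^n \mathbf 1\{X_i\le x\}$ be the empirical cdf, let $G^{-1}(u)=\inf\{x\in\mathbb R: G(x)\ge u\}$ denote the quantile function of a cdf $G$, and let $X\sim F$. For $p\in(0,1)$ put $\mu=\int_0^1F^{-1}(u)\,du$ and $$\mathrm{TVaR}^{+}(p)=\frac1{1-p}\int_p^1F^{-1}(u)\,du,\quad \mathrm{TVaR}^{-}(p)=\frac1p\int_0^pF^{-1}(u)\,du,$$ $$\mathrm{LC}(p)=\frac1\mu\int_0^pF^{-1}(u)\,du,\quad \mathrm{GC}(p)=\frac1\mu\Big(\int_{1-p}^1F^{-1}(u)\,du-\int_0^pF^{-1}(u)\,du\Big),$$ and let $\mathrm{TVaR}^{\pm}_n,\mathrm{LC}_n,\mathrm{GC}_n$ be the same functionals with $F$ (also in $\mu$) replaced by $F_n$. Fix $p\in(0,1)$ and assume that $F^{-1}$ is continuous at $p$. Normal laws with variance $0$ are understood as point masses. (1) If $\mathbb E[(X^+)^2]<\infty$, then $\sqrt n\,(\mathrm{TVaR}^+_n(p)-\mathrm{TVaR}^+(p))\xrightarrow{d}\mathcal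 N(0,\sigma_+^2(p))$ with $$\sigma_+^2(p)=\frac1{(1-p)^2}\int_{F^{-1}(p)}^\infty\int_{F^{-1}(p)}^\infty\big(F(x\wedge y)-F(x)F(y)\big)\,dx\,dy .$$ (2) If $\mathbb E[(X^-)^2]<\infty$, where $X^-=(-X)\vee 0$, then $\sqrt n\,(\mathrm{TVaR}^-_n(p)-\mathrm{TVaR}^-(p))\xrightarrow{d}\mathcal N(0,\sigma_-^2(p))$ with $$\sigma_-^2(p)=\frac1{p^2}\int_{-\infty}^{F^{-1}(p)}\int_{-\infty}^{F^{-1}(p)}\big(F(x\wedge y)-F(x)F(y)\big)\,dx\,dy .$$ (3) If $\mathbb E[X^2]<\infty$ and $\mathbb E[X]\ne0$, put $$Y_{\mathrm{LC}}(u;t)=\frac1\mu\int_{-\infty}^{F^{-1}(u)}\big(\mathbf 1\{t\le x\}-F(x)\big)\,dx+\frac{\mathrm{LC}(u)}{\mu}(t-\mu).$$ Then $$\sqrt n\,(\mathrm{LC}_n(p)-\mathrm{LC}(p))=-\frac1{\sqrt n}\sum_{i=1}^nY_{\mathrm{LC}}(p;X_i)+o_{\mathbb P}(1),$$ the random variable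 $Y_{\mathrm{LC}}(p;X)$ has mean zero and a finite second moment, and $\sqrt n\,(\mathrm{LC}_n(p)-\mathrm{LC}(p))\xrightarrow{d}\mathcal N\big(0,\mathbb E[Y_{\mathrm{LC}}(p;X)^2]\big)$. (4) If $\mathbb E[X^2]<\infty$, $\mathbb E[X]\ne0$ and $F^{-1}$ is also continuous at $1-p$, then $$\sqrt n\,(\mathrm{GC}_n(p)-\mathrm{GC}(p))=\frac1{\sqrt n}\sum_{i=1}^n\big(Y_{\mathrm{LC}}(1-p;X_i)+Y_{\mathrm{LC}}(p;X_i)\big)+o_{\mathbb P}(1),$$ and $\sqrt n\,(\mathrm{GC}_n(p)-\mathrm{GC}(p))\xrightarrow{d}\mathcal N\big(0,\mathbb E[Y_{\mathrm{GC}}(p;X)^2]\big)$, where $$Y_{\mathrm{GC}}(p;t)=\frac1\mu\int_{-\infty}^{F^{-1}(1-p)}\big(\mathbf 1\{t\le x\}-F(x)\big)\,dx+\frac1\mu\int_{-\infty}^{F^{-1}(p)}\big(\mathbf 1\{t\le x\}-F(x)\big)\,dx+\frac{1-\mathrm{GC}(p)}{\mu}(t-\mu)$$ and $Y_{\mathrm{GC}}(p;X)$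 has mean zero and a finite second moment. All integrals above are finite. -/

import Mathlib

open MeasureTheory ProbabilityTheory Filter Set

noncomputable section

/-- The generalized inverse `F⁻¹(u) = inf {x : F(x) ≥ u}` of a distribution function. It is
finite for `0 < u < 1`; the values at other `u` (in particular the endpoint values `F⁻¹(0)` and
`F⁻¹(1)`, which may be infinite) play no role below. -/
def quantile (F : ℝ → ℝ) (u : ℝ) : ℝ := sInf {x : ℝ | u ≤ F x}

/-- The mean `∫₀¹ F⁻¹(u) du` of the distribution function `F`. -/
def quantileMean (F : ℝ → ℝ) : ℝ := ∫ u in (0 : ℝ)..1, quantile F u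

/-- The upside tail-value-at-risk `(1/(1-p)) ∫_p^1 F⁻¹(u) du`. -/
def upsideTVaR (F : ℝ → ℝ) (p : ℝ) : ℝ := (1 / (1 - p)) * ∫ u in p..1, quantile F u

/-- The downside tail-value-at-risk `(1/p) ∫_0^p F⁻¹(u) du`. -/
def downsideTVaR (F : ℝ → ℝ) (p : ℝ) : ℝ := (1 / p) * ∫ u in (0 : ℝ)..p, quantile F u

/-- The Lorenz curve `(1/μ) ∫_0^p F⁻¹(u) du`. -/
def lorenzCurve (F : ℝ → ℝ) (p : ℝ) : ℝ :=
  (1 / quantileMean F) * ∫ u in (0 : ℝ)..p, quantile F u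

/-- The Gini curve `(1/μ) (∫_{1-p}^1 F⁻¹(u) du - ∫_0^p F⁻¹(u) du)`. -/
def giniCurve (F : ℝ → ℝ) (p : ℝ) : ℝ :=
  (1 / quantileMean F) * ((∫ u in (1 - p)..1, quantile F u) - ∫ u in (0 : ℝ)..p, quantile F u)

/-- The empirical distribution function of the first `n` observations. -/
def empiricalCDF {Ω : Type*} (X : ℕ → Ω → ℝ) (n : ℕ) (ω : Ω) (x : ℝ) : ℝ :=
  (1 / (n : ℝ)) * ∑ i ∈ Finset.range n, if X i ω ≤ x then (1 : ℝ) else 0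

/-- The integrand `1{t ≤ x} - F(x)`, as a function of `x`. -/
def centredIndicator (F : ℝ → ℝ) (t x : ℝ) : ℝ := (if t ≤ x then (1 : ℝ) else 0) - F x

/-- The influence function
`(1/μ) ∫_{-∞}^{F⁻¹(p)} (1{t ≤ x} - F(x)) dx + (LC(p)/μ) (t - μ)` of the Lorenz curve
at an observation `t`. -/
def lorenzInfluence (F : ℝ → ℝ) (p t : ℝ) : ℝ :=
  (1 / quantileMean F) * (∫ x in Iic (quantile F p), centredIndicator F t x)
    + (lorenzCurve F p / quantileMean F) * (t - quantileMean F)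

/-- The influence function of the Gini curve at an observation `t` (up to sign). -/
def giniInfluence (F : ℝ → ℝ) (p t : ℝ) : ℝ :=
  (1 / quantileMean F) * (∫ x in Iic (quantile F (1 - p)), centredIndicator F t x)
    + (1 / quantileMean F) * (∫ x in Iic (quantile F p), centredIndicator F t x)
    + ((1 - giniCurve F p) / quantileMean F) * (t - quantileMean F)

/-- The covariance kernel `F(x ∧ y) - F(x) F(y)`. -/
def covKernel (F : ℝ → ℝ) (x y : ℝ) : ℝ := F (min x y) - F x * F y

/-- `T n` converges in distribution to the (possibly degenerate) centred normal law with
variance `σ2`, where `σ2` is a nonnegative real number. -/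
def AsympNormal {Ω : Type*} [MeasurableSpace Ω] (P : Measure Ω) [IsProbabilityMeasure P]
    (T : ℕ → Ω → ℝ) (σ2 : ℝ) : Prop :=
  0 ≤ σ2 ∧
    TendstoInDistribution T atTop (id : ℝ → ℝ) (fun _ => P) (gaussianReal 0 σ2.toNNReal)

/-- `T n = o_P(1)`. -/
def IsLittleOP {Ω : Type*} [MeasurableSpace Ω] (P : Measure Ω) (T : ℕ → Ω → ℝ) : Prop :=
  TendstoInMeasure P T atTop (fun _ => (0 : ℝ))

end

/-! Write `q = F⁻¹(p)`. The quantile transform carries Lebesgue measure on `(0,1)` to the law, so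
the upper tail integral `∫_p^1 F⁻¹` equals `(1-p) q + E (X - q)⁺`, which is the minimum over `c` of
`(1-p) c + E (X - c)⁺`. The same identity holds for the empirical measure with its own quantile
`q_n`.

At the minimum the objective is flat. Replacing `q_n` by the fixed `q` in the empirical identity
costs at most `|q_n - q| (|F_n(q) - F(q)| + |F_n(q-) - F(q-)|)` (`abs_quantile_excess_sub_le`),
where only `F(q-) ≤ p ≤ F(q)` is used, so an atom at `q` is harmless. The bracket is `O_P(n^{-1/2})`
by Chebyshev, and `q_n → q` in probability because continuity of `F⁻¹` at `p` forces `F > p`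
immediately to the right of `q`. The cost is thus `o_P(n^{-1/2})`, with no moment assumption
(`isLittleOP_sqrt_mul_excess_sub`).

The tail integrals are therefore sample means of `(X - q)⁺` or `-(q - X)⁺` up to constants and
negligible terms, and the central limit theorem with Slutsky's lemma gives their limits. Fubini
applied to `(X - q)⁺ = ∫_q^∞ 1{x < X} dx` and its mirror image turns the variances into double
integrals of the covariance kernel. The Lorenz curve is a ratio of a lower tail integral and the
mean, and is linearised exactly up to a product `O_P(1) o_P(1)`. The Gini curve reduces to it
through `1 - GC(p) = LC(1-p) + LC(p)`. -/

/-! ### Quantile functions, the quantile transform and tail integrals. -/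

section QuantileFunction

variable (ν : Measure ℝ)

/-- The limits of `F` at `±∞` make the set defining the infimum nonempty and bounded below, and
right continuity shows that the infimum is attained. All later facts about quantiles rest on this
Galois connection. -/
lemma quantile_cdf_le_iff {u : ℝ} (hu : u ∈ Ioo (0 : ℝ) 1) (x : ℝ) :
    quantile (cdf ν) u ≤ x ↔ u ≤ cdf ν x := by
  have hbdd : BddBelow {x : ℝ | u ≤ cdf ν x} := by
    obtain ⟨b, hb⟩ := ((tendsto_cdf_atBot ν).eventually_lt_const hu.1).exists
    refine ⟨b, fun y hy => ?_⟩
    by_contra! h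
    exact (hy.trans (monotone_cdf ν h.le)).not_gt hb
  have hne : {x : ℝ | u ≤ cdf ν x}.Nonempty := by
    obtain ⟨b, hb⟩ := ((tendsto_cdf_atTop ν).eventually_const_lt hu.2).exists
    exact ⟨b, hb.le⟩
  refine ⟨fun h => ?_, fun h => csInf_le hbdd h⟩
  have hright : ∀ y, x < y → u ≤ cdf ν y := by
    intro y hy
    obtain ⟨z, hz, hzy⟩ := exists_lt_of_csInf_lt hne (h.trans_lt hy)
    exact (show u ≤ cdf ν z from hz).trans (monotone_cdf ν hzy.le)
  have ht : Tendsto (cdf ν) (nhdsWithin x (Ioi x)) (nhds (cdf ν x)) :=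
    ((cdf ν).right_continuous x).mono_left (nhdsWithin_mono _ Ioi_subset_Ici_self)
  exact ge_of_tendsto ht (eventually_mem_nhdsWithin.mono hright)

lemma le_cdf_quantile {u : ℝ} (hu : u ∈ Ioo (0 : ℝ) 1) : u ≤ cdf ν (quantile (cdf ν) u) :=
  (quantile_cdf_le_iff ν hu _).1 le_rfl

lemma monotoneOn_quantile_cdf : MonotoneOn (quantile (cdf ν)) (Ioo 0 1) := fun _ ha _ hb hab =>
  (quantile_cdf_le_iff ν ha _).2 (hab.trans (le_cdf_quantile ν hb))

lemma aemeasurable_quantile_cdf :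
    AEMeasurable (quantile (cdf ν)) (volume.restrict (Ioo (0 : ℝ) 1)) :=
  aemeasurable_restrict_of_monotoneOn measurableSet_Ioo (monotoneOn_quantile_cdf ν)

variable [IsProbabilityMeasure ν]

lemma measureReal_Iio_quantile_le {u : ℝ} (hu : u ∈ Ioo (0 : ℝ) 1) :
    ν.real (Iio (quantile (cdf ν) u)) ≤ u := by
  have h1 : ∀ x < quantile (cdf ν) u, ν.real (Iic x) ≤ u := by
    intro x hx
    rw [← cdf_eq_real]
    exact (not_le.1 (mt (quantile_cdf_le_iff ν hu x).2 hx.not_ge)).le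
  obtain ⟨s, hs, hlt, hst⟩ := exists_seq_strictMono_tendsto (quantile (cdf ν) u)
  have hU : Iio (quantile (cdf ν) u) = ⋃ n, Iic (s n) := by
    ext x
    simp only [mem_Iio, mem_iUnion, mem_Iic]
    refine ⟨fun hx => ?_, fun ⟨n, hn⟩ => hn.trans_lt (hlt n)⟩
    obtain ⟨n, hn⟩ := (hst.eventually_const_lt hx).exists
    exact ⟨n, hn.le⟩
  have hmono : Monotone fun n => Iic (s n) := fun i j hij => Iic_subset_Iic.2 (hs.monotone hij)
  have ht := tendsto_measure_iUnion_atTop (μ := ν) hmono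
  rw [← hU] at ht
  have ht' := (ENNReal.tendsto_toReal (measure_ne_top ν _)).comp ht
  exact le_of_tendsto' ht' fun n => h1 _ (hlt n)

/-- By the Galois connection the preimage of `Iic x` in `(0,1)` is `{u | u ≤ F x}`, of length `F x`.
-/
lemma map_quantile_cdf : (volume.restrict (Ioo (0 : ℝ) 1)).map (quantile (cdf ν)) = ν := by
  have : IsFiniteMeasure ((volume.restrict (Ioo (0 : ℝ) 1)).map (quantile (cdf ν))) :=
    Measure.isFiniteMeasure_map _ _
  refine Measure.ext_of_Iic _ _ fun x => ?_
  have hm := aemeasurable_quantile_cdf ν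
  rw [Measure.map_apply_of_aemeasurable hm measurableSet_Iic,
    Measure.restrict_apply₀ (hm.nullMeasurableSet_preimage measurableSet_Iic), ← ofReal_cdf]
  have hset : quantile (cdf ν) ⁻¹' Iic x ∩ Ioo 0 1 = Iic (cdf ν x) ∩ Ioo 0 1 := by
    ext u
    simp only [mem_inter_iff, mem_preimage, mem_Iic]
    exact and_congr_left fun hu => quantile_cdf_le_iff ν hu x
  rw [hset]
  apply le_antisymm
  · calc volume (Iic (cdf ν x) ∩ Ioo 0 1) ≤ volume (Ioc 0 (cdf ν x)) :=
          measure_mono fun u hu => ⟨hu.2.1, hu.1⟩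
      _ = _ := by simp
  · calc ENNReal.ofReal (cdf ν x) = volume (Ioo 0 (cdf ν x)) := by simp
      _ ≤ volume (Iic (cdf ν x) ∩ Ioo 0 1) :=
          measure_mono fun u hu => ⟨hu.2.le, hu.1, hu.2.trans_le (cdf_le_one ν x)⟩

lemma integrableOn_comp_quantile_iff {g : ℝ → ℝ} (hg : Measurable g) :
    IntegrableOn (fun u => g (quantile (cdf ν) u)) (Ioo 0 1) ↔ Integrable g ν := by
  have h := integrable_map_measure (g := g) (μ := volume.restrict (Ioo (0 : ℝ) 1))
    (f := quantile (cdf ν)) hg.aestronglyMeasurable (aemeasurable_quantile_cdf ν)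
  rw [map_quantile_cdf] at h
  exact h.symm

lemma integral_comp_quantile {g : ℝ → ℝ} (hg : Measurable g) :
    ∫ u in Ioo 0 1, g (quantile (cdf ν) u) = ∫ x, g x ∂ν := by
  have h := integral_map (f := g) (μ := volume.restrict (Ioo (0 : ℝ) 1))
    (aemeasurable_quantile_cdf ν) hg.aestronglyMeasurable
  rw [map_quantile_cdf] at h
  exact h.symm

variable {p : ℝ} (hp : p ∈ Ioo (0 : ℝ) 1)
include hp

omit [IsProbabilityMeasure ν] in
lemma quantile_sub_eqOn_upper : EqOn (fun u => quantile (cdf ν) u - quantile (cdf ν) p)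
    (fun u => max (quantile (cdf ν) u - quantile (cdf ν) p) 0) (Ioo p 1) := fun _ hu =>
  (max_eq_left (sub_nonneg.2 (monotoneOn_quantile_cdf ν hp ⟨hp.1.trans hu.1, hu.2⟩ hu.1.le))).symm

omit [IsProbabilityMeasure ν] in
lemma quantile_sub_eqOn_lower : EqOn (fun u => quantile (cdf ν) p - quantile (cdf ν) u)
    (fun u => max (quantile (cdf ν) p - quantile (cdf ν) u) 0) (Ioc 0 p) := fun _ hu =>
  (max_eq_left (sub_nonneg.2
    (monotoneOn_quantile_cdf ν ⟨hu.1, hu.2.trans_lt hp.2⟩ hp hu.2))).symm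

lemma integrableOn_quantile_upper
    (h : Integrable (fun x => max (x - quantile (cdf ν) p) 0) ν) :
    IntegrableOn (fun u => quantile (cdf ν) u - quantile (cdf ν) p) (Ioo p 1) := by
  rw [integrableOn_congr_fun (quantile_sub_eqOn_upper ν hp) measurableSet_Ioo]
  exact ((integrableOn_comp_quantile_iff ν (by fun_prop)).2 h).mono_set
    (Ioo_subset_Ioo hp.1.le le_rfl)

lemma integrableOn_quantile_lower
    (h : Integrable (fun x => max (quantile (cdf ν) p - x) 0) ν) :
    IntegrableOn (fun u => quantile (cdf ν) p - quantile (cdf ν) u) (Ioc 0 p) := by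
  rw [integrableOn_congr_fun (quantile_sub_eqOn_lower ν hp) measurableSet_Ioc]
  exact ((integrableOn_comp_quantile_iff ν
    (g := fun x => max (quantile (cdf ν) p - x) 0) (by fun_prop)).2 h).mono_set
    fun u hu => ⟨hu.1, hu.2.trans_lt hp.2⟩

lemma intervalIntegrable_quantile_upper
    (h : Integrable (fun x => max (x - quantile (cdf ν) p) 0) ν) :
    IntervalIntegrable (quantile (cdf ν)) volume p 1 := by
  rw [intervalIntegrable_iff_integrableOn_Ioo_of_le hp.2.le]
  have := (integrableOn_quantile_upper ν hp h).add
    (integrableOn_const (C := quantile (cdf ν) p) (s := Ioo p 1) (by simp))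
  exact this.congr_fun (fun u _ => by simp) measurableSet_Ioo

lemma intervalIntegrable_quantile_lower
    (h : Integrable (fun x => max (quantile (cdf ν) p - x) 0) ν) :
    IntervalIntegrable (quantile (cdf ν)) volume 0 p := by
  rw [intervalIntegrable_iff_integrableOn_Ioc_of_le hp.1.le]
  have := (integrableOn_const (C := quantile (cdf ν) p) (s := Ioc 0 p) (by simp)).sub
    (integrableOn_quantile_lower ν hp h)
  exact this.congr_fun (fun u _ => by simp) measurableSet_Ioc

/-- The upper tail integral of the quantile function as an expected excess. -/
lemma integral_quantile_upper
    (h : Integrable (fun x => max (x - quantile (cdf ν) p) 0) ν) :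
    ∫ u in p..1, quantile (cdf ν) u =
      (1 - p) * quantile (cdf ν) p + ∫ x, max (x - quantile (cdf ν) p) 0 ∂ν := by
  have h1 : ∫ u in Ioo p 1, (quantile (cdf ν) u - quantile (cdf ν) p) =
      ∫ x, max (x - quantile (cdf ν) p) 0 ∂ν := by
    rw [← integral_comp_quantile ν (g := fun x => max (x - quantile (cdf ν) p) 0) (by fun_prop),
      setIntegral_congr_fun measurableSet_Ioo (quantile_sub_eqOn_upper ν hp)]
    -- By monotonicity the positive part vanishes for `u ≤ p`, so the integral extends to all of
    -- `(0,1)`, where the quantile transform applies.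
    refine (setIntegral_eq_of_subset_of_forall_sdiff_eq_zero measurableSet_Ioo
      (Ioo_subset_Ioo hp.1.le le_rfl) fun u hu => max_eq_right ?_).symm
    refine sub_nonpos.2 (monotoneOn_quantile_cdf ν hu.1 hp ?_)
    by_contra! hlt
    exact hu.2 ⟨hlt, hu.1.2⟩
  have h2 := integral_const (μ := volume.restrict (Ioo p 1)) (quantile (cdf ν) p)
  rw [← h1, intervalIntegral.integral_of_le hp.2.le, integral_Ioc_eq_integral_Ioo]
  have h3 := integral_add (integrableOn_quantile_upper ν hp h)
    (integrableOn_const (C := quantile (cdf ν) p) (s := Ioo p 1) (by simp))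
  simp only [sub_add_cancel] at h3
  rw [h3, h2]
  simp [hp.2.le]
  ring

/-- The lower tail integral of the quantile function as an expected shortfall. -/
lemma integral_quantile_lower
    (h : Integrable (fun x => max (quantile (cdf ν) p - x) 0) ν) :
    ∫ u in (0 : ℝ)..p, quantile (cdf ν) u =
      p * quantile (cdf ν) p - ∫ x, max (quantile (cdf ν) p - x) 0 ∂ν := by
  have h1 : ∫ u in Ioc 0 p, (quantile (cdf ν) p - quantile (cdf ν) u) =
      ∫ x, max (quantile (cdf ν) p - x) 0 ∂ν := by
    rw [← integral_comp_quantile ν (g := fun x => max (quantile (cdf ν) p - x) 0) (by fun_prop),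
      setIntegral_congr_fun measurableSet_Ioc (quantile_sub_eqOn_lower ν hp)]
    refine (setIntegral_eq_of_subset_of_forall_sdiff_eq_zero measurableSet_Ioo
      (fun u hu => ⟨hu.1, hu.2.trans_lt hp.2⟩) fun u hu => max_eq_right ?_).symm
    refine sub_nonpos.2 (monotoneOn_quantile_cdf ν hp hu.1 ?_)
    by_contra! hlt
    exact hu.2 ⟨hu.1.1, hlt.le⟩
  have h2 := integral_const (μ := volume.restrict (Ioc 0 p)) (quantile (cdf ν) p)
  rw [← h1, intervalIntegral.integral_of_le hp.1.le]
  have h3 := integral_sub (integrableOn_const (C := quantile (cdf ν) p) (s := Ioc 0 p) (by simp))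
    (integrableOn_quantile_lower ν hp h)
  simp only [sub_sub_cancel] at h3
  rw [h3, h2]
  simp [hp.1.le]

omit hp

lemma intervalIntegrable_quantile (h : Integrable (fun x : ℝ => x) ν) :
    IntervalIntegrable (quantile (cdf ν)) volume 0 1 := by
  rw [intervalIntegrable_iff_integrableOn_Ioo_of_le zero_le_one]
  exact (integrableOn_comp_quantile_iff ν measurable_id).2 h

lemma quantileMean_cdf : quantileMean (cdf ν) = ∫ x, x ∂ν := by
  rw [quantileMean, intervalIntegral.integral_of_le zero_le_one, integral_Ioc_eq_integral_Ioo]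
  exact integral_comp_quantile ν measurable_id

/-- The tail integral of the quantile function minimises `c ↦ (1 - p) c + E (x - c)⁺`, so replacing
the minimiser by `c` costs at most second order. -/
lemma abs_quantile_excess_sub_le {p : ℝ} (hp : p ∈ Ioo (0 : ℝ) 1) (c a b : ℝ) (ha : p ≤ a)
    (hb : b ≤ p) (hint : ∀ z : ℝ, Integrable (fun x => max (x - z) 0) ν) :
    |(1 - p) * c + ∫ x, max (x - c) 0 ∂ν -
        ((1 - p) * quantile (cdf ν) p + ∫ x, max (x - quantile (cdf ν) p) 0 ∂ν)| ≤
      |quantile (cdf ν) p - c| * (|cdf ν c - a| + |ν.real (Iio c) - b|) := by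
  set q := quantile (cdf ν) p with hq
  have hq1 : p ≤ ν.real (Iic q) := by rw [← cdf_eq_real]; exact le_cdf_quantile ν hp
  have hq2 : ν.real (Iio q) ≤ p := measureReal_Iio_quantile_le ν hp
  have hI : ∀ s : Set ℝ, MeasurableSet s →
      ∫ x, (q - c) * (1 - s.indicator (fun _ => (1 : ℝ)) x) ∂ν = (q - c) * (1 - ν.real s) := by
    intro s hs
    rw [integral_const_mul, integral_sub (integrable_const _)
      ((integrable_const _).indicator hs), integral_indicator hs]
    simp
  have hInt : ∀ s : Set ℝ, MeasurableSet s →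
      Integrable (fun x => (q - c) * (1 - s.indicator (fun _ => (1 : ℝ)) x)) ν := fun s hs =>
    ((integrable_const _).sub ((integrable_const _).indicator hs)).const_mul _
  have hup : ∀ s : Set ℝ, MeasurableSet s →
      (∀ x, max (x - c) 0 - max (x - q) 0 ≤ (q - c) * (1 - s.indicator (fun _ => (1 : ℝ)) x)) →
      ∫ x, max (x - c) 0 ∂ν - ∫ x, max (x - q) 0 ∂ν ≤ (q - c) * (1 - ν.real s) := by
    intro s hs h
    rw [← integral_sub (hint c) (hint q), ← hI s hs]
    exact integral_mono ((hint c).sub (hint q)) (hInt s hs) h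
  have hlow : ∀ s : Set ℝ, MeasurableSet s →
      (∀ x, (q - c) * (1 - s.indicator (fun _ => (1 : ℝ)) x) ≤ max (x - c) 0 - max (x - q) 0) →
      (q - c) * (1 - ν.real s) ≤ ∫ x, max (x - c) 0 ∂ν - ∫ x, max (x - q) 0 ∂ν := by
    intro s hs h
    rw [← integral_sub (hint c) (hint q), ← hI s hs]
    exact integral_mono (hInt s hs) ((hint c).sub (hint q)) h
  rw [cdf_eq_real ν c]
  -- In either order the increment `(x - c)⁺ - (x - q)⁺` lies between two multiples of indicators.
  -- The one cutting at `q` gives minimality of `q`, the one cutting at `c` gives the upper bound;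
  -- open or closed half-lines are chosen so that `ν(Iio q) ≤ p ≤ ν(Iic q)` and `b ≤ p ≤ a` enter
  -- with the right sign.
  rcases le_total c q with hcq | hqc
  · have h1 := hup (Iic c) measurableSet_Iic fun x => by
      by_cases hx : x ≤ c
      · simp [hx, hx.trans hcq]
      · simp only [indicator, mem_Iic, hx, if_false]
        rcases max_cases (x - c) 0 with h | h <;> rcases max_cases (x - q) 0 with h' | h' <;>
          linarith
    have h2 := hlow (Iio q) measurableSet_Iio fun x => by
      by_cases hx : x < q
      · simp only [indicator, mem_Iio, hx, if_true]
        rcases max_cases (x - c) 0 with h | h <;> rcases max_cases (x - q) 0 with h' | h' <;>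
          linarith
      · simp only [indicator, mem_Iio, hx, if_false]
        rcases max_cases (x - c) 0 with h | h <;> rcases max_cases (x - q) 0 with h' | h' <;>
          linarith
    rw [abs_of_nonneg (sub_nonneg.2 hcq), abs_of_nonneg]
    · have := mul_le_mul_of_nonneg_left (neg_le_abs (ν.real (Iic c) - a)) (sub_nonneg.2 hcq)
      have := mul_nonneg (sub_nonneg.2 hcq) (abs_nonneg (ν.real (Iio c) - b))
      have := mul_le_mul_of_nonneg_left ha (sub_nonneg.2 hcq)
      linarith
    · have := mul_le_mul_of_nonneg_left hq2 (sub_nonneg.2 hcq)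
      linarith
  · have h1 := hup (Iio c) measurableSet_Iio fun x => by
      by_cases hx : x < c
      · simp only [indicator, mem_Iio, hx, if_true]
        rcases max_cases (x - c) 0 with h | h <;> rcases max_cases (x - q) 0 with h' | h' <;>
          linarith
      · simp only [indicator, mem_Iio, hx, if_false]
        rcases max_cases (x - c) 0 with h | h <;> rcases max_cases (x - q) 0 with h' | h' <;>
          linarith
    have h2 := hlow (Iic q) measurableSet_Iic fun x => by
      by_cases hx : x ≤ q
      · simp [hx, hx.trans hqc]
      · simp only [indicator, mem_Iic, hx, if_false]
        rcases max_cases (x - c) 0 with h | h <;> rcases max_cases (x - q) 0 with h' | h' <;>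
          linarith
    rw [abs_of_nonpos (sub_nonpos.2 hqc), abs_of_nonneg]
    · have := mul_le_mul_of_nonneg_left (le_abs_self (ν.real (Iio c) - b)) (sub_nonneg.2 hqc)
      have := mul_nonneg (sub_nonneg.2 hqc) (abs_nonneg (ν.real (Iic c) - a))
      have := mul_le_mul_of_nonneg_left hb (sub_nonneg.2 hqc)
      linarith
    · have := mul_le_mul_of_nonneg_left hq1 (sub_nonneg.2 hqc)
      linarith

end QuantileFunction

/-! ### Variances as double integrals of the covariance kernel. -/

section CovarianceKernel

variable (ν : Measure ℝ) [IsProbabilityMeasure ν]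

/-- Fubini for a random variable `g t = ∫ 1{(x, t) ∈ K} dx` with a second moment: the functions
`x ↦ ν {t | (x, t) ∈ K}` and `(x, y) ↦ ν {t | (x, t) ∈ K, (y, t) ∈ K}` are integrable, with integrals
the first and the second moment of `g`. -/
lemma integrable_section_measure {μ : Measure ℝ} [SFinite μ] {K : Set (ℝ × ℝ)}
    (hK : MeasurableSet K) {g : ℝ → ℝ} (hg0 : ∀ t, 0 ≤ g t)
    (hg : ∀ t, μ {x | (x, t) ∈ K} = ENNReal.ofReal (g t)) (hL : MemLp g 2 ν) :
    (Integrable (fun x => ν.real {t | (x, t) ∈ K}) μ ∧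
      ∫ x, ν.real {t | (x, t) ∈ K} ∂μ = ∫ t, g t ∂ν) ∧
    Integrable (fun z : ℝ × ℝ => ν.real {t | (z.1, t) ∈ K ∧ (z.2, t) ∈ K}) (μ.prod μ) ∧
      ∫ z : ℝ × ℝ, ν.real {t | (z.1, t) ∈ K ∧ (z.2, t) ∈ K} ∂(μ.prod μ) = ∫ t, g t ^ 2 ∂ν := by
  have key : ∀ {β : Type} [MeasurableSpace β] (m : Measure β) [SFinite m] (A : Set (β × ℝ))
      (f : ℝ → ℝ), MeasurableSet A → (∀ t, 0 ≤ f t) → Integrable f ν →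
      (∀ t, m {x | (x, t) ∈ A} = ENNReal.ofReal (f t)) →
      Integrable (fun x => ν.real {t | (x, t) ∈ A}) m ∧
        ∫ x, ν.real {t | (x, t) ∈ A} ∂m = ∫ t, f t ∂ν := by
    intro β _ m _ A f hA hf0 hfi hm
    have hmeas : Measurable fun x => ν {t | (x, t) ∈ A} := measurable_measure_prodMk_left hA
    have h1 : ∫⁻ x, ν {t | (x, t) ∈ A} ∂m = ∫⁻ t, ENNReal.ofReal (f t) ∂ν := by
      have ha := Measure.prod_apply (μ := m) (ν := ν) hA
      have hb := Measure.prod_apply_symm (μ := m) (ν := ν) hA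
      simp only [preimage] at ha hb
      rw [← ha, hb]
      exact lintegral_congr hm
    have h2 : ∫⁻ x, ν {t | (x, t) ∈ A} ∂m ≠ ⊤ := by
      rw [h1]
      exact hfi.lintegral_lt_top.ne
    refine ⟨integrable_toReal_of_lintegral_ne_top hmeas.aemeasurable h2, ?_⟩
    rw [integral_eq_lintegral_of_nonneg_ae (ae_of_all _ hf0) hfi.aestronglyMeasurable, ← h1]
    exact integral_toReal hmeas.aemeasurable (ae_lt_top hmeas h2)
  refine ⟨key μ K g hK hg0 (hL.integrable one_le_two) hg, ?_⟩
  refine key (μ.prod μ) {w | (w.1.1, w.2) ∈ K ∧ (w.1.2, w.2) ∈ K} (fun t => g t ^ 2) ?_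
    (fun t => sq_nonneg _) hL.integrable_sq fun t => ?_
  · exact (hK.preimage (by fun_prop)).inter (hK.preimage (by fun_prop))
  · have : {x : ℝ × ℝ | (x, t) ∈ {w : (ℝ × ℝ) × ℝ | (w.1.1, w.2) ∈ K ∧ (w.1.2, w.2) ∈ K}} =
        {x | (x, t) ∈ K} ×ˢ {x | (x, t) ∈ K} := by
      ext x; simp
    rw [this, Measure.prod_prod, hg t, ← ENNReal.ofReal_mul (hg0 t), sq]

lemma integrable_and_integral_covKernel {μ : Measure ℝ} [SFinite μ] {F : ℝ → ℝ}
    {K : Set (ℝ × ℝ)} (hK : MeasurableSet K) {g : ℝ → ℝ} (hg0 : ∀ t, 0 ≤ g t)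
    (hg : ∀ t, μ {x | (x, t) ∈ K} = ENNReal.ofReal (g t)) (hL : MemLp g 2 ν)
    (hcov : ∀ x y, covKernel F x y = ν.real {t | (x, t) ∈ K ∧ (y, t) ∈ K} -
      ν.real {t | (x, t) ∈ K} * ν.real {t | (y, t) ∈ K}) :
    Integrable (fun z : ℝ × ℝ => covKernel F z.1 z.2) (μ.prod μ) ∧
      ∫ x, ∫ y, covKernel F x y ∂μ ∂μ = Var[g; ν] := by
  obtain ⟨⟨h1, h1'⟩, h2, h2'⟩ := integrable_section_measure ν hK hg0 hg hL
  have h3 := h1.mul_prod h1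
  have hI : Integrable (fun z : ℝ × ℝ => covKernel F z.1 z.2) (μ.prod μ) := by
    simp_rw [hcov]
    exact h2.sub h3
  refine ⟨hI, ?_⟩
  rw [← integral_prod (fun z : ℝ × ℝ => covKernel F z.1 z.2) hI]
  simp_rw [hcov]
  rw [integral_sub h2 h3, h2', integral_prod_mul (fun x => ν.real {t | (x, t) ∈ K})
    (fun x => ν.real {t | (x, t) ∈ K}), h1', variance_eq_sub hL]
  simp [sq]

lemma covKernel_upper (c : ℝ) (hL : MemLp (fun x => max (x - c) 0) 2 ν) :
    IntegrableOn (fun z : ℝ × ℝ => covKernel (cdf ν) z.1 z.2) (Ioi c ×ˢ Ioi c) ∧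
      ∫ x in Ioi c, ∫ y in Ioi c, covKernel (cdf ν) x y = Var[fun x => max (x - c) 0; ν] := by
  have h := integrable_and_integral_covKernel ν (μ := volume.restrict (Ioi c)) (F := cdf ν)
    (K := {w | w.1 < w.2}) (measurableSet_lt measurable_fst measurable_snd)
    (g := fun x => max (x - c) 0) (fun t => le_max_right _ _) (fun t => ?_) hL (fun x y => ?_)
  · rw [Measure.prod_restrict] at h
    exact h
  · rw [Measure.restrict_apply (by exact measurableSet_Iio)]
    have : {x | (x, t) ∈ {w : ℝ × ℝ | w.1 < w.2}} ∩ Ioi c = Ioo c t := by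
      ext x; simp [and_comm]
    rw [this, Real.volume_Ioo, ENNReal.ofReal_max]
    simp
  -- The indicators here are of `Ioi`, complementary to those in `F`; passing to complements in both
  -- leaves the covariance unchanged.
  · have hs : ∀ x, ν.real (Ioi x) = 1 - cdf ν x := fun x => by
      rw [cdf_eq_real, ← compl_Iic, probReal_compl_eq_one_sub measurableSet_Iic]
    have e1 : {t | (x, t) ∈ {w : ℝ × ℝ | w.1 < w.2} ∧ (y, t) ∈ {w : ℝ × ℝ | w.1 < w.2}} =
        Ioi (max x y) := by
      ext t; simp
    have e2 : ∀ x : ℝ, {t | (x, t) ∈ {w : ℝ × ℝ | w.1 < w.2}} = Ioi x := fun x => rfl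
    rw [e1, e2, e2, hs, hs, hs, covKernel]
    rcases le_total x y with hxy | hxy <;> simp only [hxy, min_eq_left, min_eq_right, max_eq_left,
      max_eq_right] <;> ring

lemma covKernel_lower (c : ℝ) (hL : MemLp (fun x => max (c - x) 0) 2 ν) :
    IntegrableOn (fun z : ℝ × ℝ => covKernel (cdf ν) z.1 z.2) (Iic c ×ˢ Iic c) ∧
      ∫ x in Iic c, ∫ y in Iic c, covKernel (cdf ν) x y = Var[fun x => max (c - x) 0; ν] := by
  have h := integrable_and_integral_covKernel ν (μ := volume.restrict (Iic c)) (F := cdf ν)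
    (K := {w | w.2 ≤ w.1}) (measurableSet_le measurable_snd measurable_fst)
    (g := fun x => max (c - x) 0) (fun t => le_max_right _ _) (fun t => ?_) hL (fun x y => ?_)
  · rw [Measure.prod_restrict] at h
    exact h
  · rw [Measure.restrict_apply (by exact measurableSet_Ici)]
    have : {x | (x, t) ∈ {w : ℝ × ℝ | w.2 ≤ w.1}} ∩ Iic c = Icc t c := by
      ext x; simp
    rw [this, Real.volume_Icc, ENNReal.ofReal_max]
    simp
  · have e1 : {t | (x, t) ∈ {w : ℝ × ℝ | w.2 ≤ w.1} ∧ (y, t) ∈ {w : ℝ × ℝ | w.2 ≤ w.1}} =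
        Iic (min x y) := by
      ext t; simp
    have e2 : ∀ x : ℝ, {t | (x, t) ∈ {w : ℝ × ℝ | w.2 ≤ w.1}} = Iic x := fun x => rfl
    rw [e1, e2, e2, ← cdf_eq_real, ← cdf_eq_real, ← cdf_eq_real, covKernel]

/-- The integral of the centred indicator is a centred shortfall. -/
lemma integral_centredIndicator (c : ℝ) (hL : MemLp (fun x => max (c - x) 0) 2 ν) (t : ℝ) :
    IntegrableOn (centredIndicator (cdf ν) t) (Iic c) ∧
      ∫ x in Iic c, centredIndicator (cdf ν) t x =
        max (c - t) 0 - ∫ x, max (c - x) 0 ∂ν := by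
  have hvol : ∀ t, (volume.restrict (Iic c)) {x | (x, t) ∈ {w : ℝ × ℝ | w.2 ≤ w.1}} =
      ENNReal.ofReal (max (c - t) 0) := fun t => by
    rw [Measure.restrict_apply (by exact measurableSet_Ici)]
    have : {x | (x, t) ∈ {w : ℝ × ℝ | w.2 ≤ w.1}} ∩ Iic c = Icc t c := by
      ext x; simp
    rw [this, Real.volume_Icc, ENNReal.ofReal_max]
    simp
  obtain ⟨⟨h1, h1'⟩, -⟩ := integrable_section_measure ν (μ := volume.restrict (Iic c))
    (K := {w | w.2 ≤ w.1}) (measurableSet_le measurable_snd measurable_fst)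
    (g := fun x => max (c - x) 0) (fun t => le_max_right _ _) hvol hL
  have e2 : ∀ x : ℝ, ν.real {t | (x, t) ∈ {w : ℝ × ℝ | w.2 ≤ w.1}} = cdf ν x := fun x =>
    (cdf_eq_real ν x).symm
  simp_rw [e2] at h1 h1'
  have h3 : (fun x : ℝ => if t ≤ x then (1 : ℝ) else 0) = (Ici t).indicator fun _ => (1 : ℝ) := by
    ext x; simp [indicator]
  have hvt : (volume.restrict (Iic c)) (Ici t) = ENNReal.ofReal (max (c - t) 0) := hvol t
  have h4 : Integrable (fun x : ℝ => if t ≤ x then (1 : ℝ) else 0) (volume.restrict (Iic c)) := by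
    rw [h3]
    exact (integrable_indicator_iff measurableSet_Ici).2
      (integrableOn_const (by rw [hvt]; exact ENNReal.ofReal_ne_top))
  refine ⟨h4.sub h1, ?_⟩
  unfold centredIndicator
  rw [integral_sub h4 h1, h1', h3, integral_indicator measurableSet_Ici]
  simp only [Measure.real, hvt, setIntegral_const, smul_eq_mul, mul_one]
  rw [ENNReal.toReal_ofReal (le_max_right _ _)]

end CovarianceKernel

/-! ### Calculus of `o_P` and `O_P`. -/

section StochasticOrders

variable {Ω : Type*} [MeasurableSpace Ω] {P : Measure Ω} [IsProbabilityMeasure P]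

lemma isLittleOP_iff {T : ℕ → Ω → ℝ} :
    IsLittleOP P T ↔ ∀ ε, 0 < ε → Tendsto (fun n => P.real {ω | ε ≤ |T n ω|}) atTop (nhds 0) := by
  rw [IsLittleOP, tendstoInMeasure_iff_measureReal_norm]
  simp

/-- Domination on events `{|D n| < δ}` whose probabilities tend to one. -/
lemma IsLittleOP.of_abs_le {T B D : ℕ → Ω → ℝ} (hB : IsLittleOP P B) (hD : IsLittleOP P D)
    {δ : ℝ} (hδ : 0 < δ) (h : ∀ᶠ n in atTop, ∀ ω, |D n ω| < δ → |T n ω| ≤ |B n ω|) :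
    IsLittleOP P T := by
  rw [isLittleOP_iff] at hB hD ⊢
  intro ε hε
  have ht := (hB ε hε).add (hD δ hδ)
  rw [add_zero] at ht
  refine squeeze_zero' (Eventually.of_forall fun n => measureReal_nonneg) ?_ ht
  filter_upwards [h] with n hn
  refine (measureReal_mono fun ω hω => ?_).trans (measureReal_union_le _ _)
  rcases lt_or_ge (|D n ω|) δ with hlt | hge
  · exact Or.inl (le_trans hω (hn ω hlt))
  · exact Or.inr hge

lemma IsLittleOP.mono {T B : ℕ → Ω → ℝ} (hB : IsLittleOP P B)
    (h : ∀ᶠ n in atTop, ∀ ω, |T n ω| ≤ |B n ω|) : IsLittleOP P T :=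
  hB.of_abs_le hB one_pos (h.mono fun _ hn ω _ => hn ω)

lemma IsLittleOP.add {T S : ℕ → Ω → ℝ} (hT : IsLittleOP P T) (hS : IsLittleOP P S) :
    IsLittleOP P fun n ω => T n ω + S n ω := by
  rw [isLittleOP_iff] at *
  intro ε hε
  have ht := (hT (ε / 2) (by positivity)).add (hS (ε / 2) (by positivity))
  rw [add_zero] at ht
  refine squeeze_zero (fun n => measureReal_nonneg) (fun n => ?_) ht
  refine (measureReal_mono fun ω hω => ?_).trans (measureReal_union_le _ _)
  by_contra hc
  simp only [mem_union, mem_ofPred_eq, not_or, not_le] at hc hω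
  linarith [abs_add_le (T n ω) (S n ω)]

lemma IsLittleOP.const_mul {T : ℕ → Ω → ℝ} (hT : IsLittleOP P T) (c : ℝ) :
    IsLittleOP P fun n ω => c * T n ω := by
  rw [isLittleOP_iff] at *
  intro ε hε
  refine squeeze_zero (fun n => measureReal_nonneg) (fun n => ?_)
    (hT (ε / (|c| + 1)) (by positivity))
  refine measureReal_mono fun ω hω => ?_
  simp only [mem_ofPred_eq, abs_mul] at hω ⊢
  rw [div_le_iff₀ (by positivity)]
  nlinarith [abs_nonneg (T n ω)]

/-- `T n = O_P(1)`. -/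
def IsBigOP (P : Measure Ω) (T : ℕ → Ω → ℝ) : Prop :=
  ∀ ε, 0 < ε → ∃ M, 0 < M ∧ ∀ n, P.real {ω | M ≤ |T n ω|} ≤ ε

lemma IsBigOP.add {T S : ℕ → Ω → ℝ} (hT : IsBigOP P T) (hS : IsBigOP P S) :
    IsBigOP P fun n ω => T n ω + S n ω := by
  intro ε hε
  obtain ⟨M, hM, h1⟩ := hT (ε / 2) (by positivity)
  obtain ⟨N, hN, h2⟩ := hS (ε / 2) (by positivity)
  refine ⟨M + N, by positivity, fun n => ?_⟩
  refine ((measureReal_mono fun ω hω => ?_).trans (measureReal_union_le _ _)).trans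
    ((add_le_add (h1 n) (h2 n)).trans (by linarith))
  by_contra hc
  simp only [mem_union, mem_ofPred_eq, not_or, not_le] at hc hω
  linarith [abs_add_le (T n ω) (S n ω)]

omit [IsProbabilityMeasure P] in
lemma IsBigOP.abs {T : ℕ → Ω → ℝ} (hT : IsBigOP P T) : IsBigOP P fun n ω => |T n ω| := by
  simpa only [IsBigOP, abs_abs] using hT

lemma IsBigOP.mul_isLittleOP {T S : ℕ → Ω → ℝ} (hT : IsBigOP P T) (hS : IsLittleOP P S) :
    IsLittleOP P fun n ω => T n ω * S n ω := by
  rw [isLittleOP_iff] at *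
  intro ε hε
  rw [Metric.tendsto_atTop]
  intro η hη
  obtain ⟨M, hM, h1⟩ := hT (η / 2) (by positivity)
  obtain ⟨N, hN⟩ := Metric.tendsto_atTop.1 (hS (ε / M) (by positivity)) (η / 2) (by positivity)
  refine ⟨N, fun n hn => ?_⟩
  have h2 := hN n hn
  rw [Real.dist_0_eq_abs, abs_of_nonneg measureReal_nonneg] at h2 ⊢
  have hsub : {ω | ε ≤ |T n ω * S n ω|} ⊆ {ω | M ≤ |T n ω|} ∪ {ω | ε / M ≤ |S n ω|} := by
    intro ω hω
    by_contra hc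
    simp only [mem_union, mem_ofPred_eq, not_or, not_le, abs_mul] at hc hω
    have := mul_le_mul hc.1.le hc.2.le (abs_nonneg _) hM.le
    have h3 : |T n ω| * |S n ω| < ε := by
      calc |T n ω| * |S n ω| ≤ M * |S n ω| := by gcongr; exact hc.1.le
        _ < M * (ε / M) := by gcongr; exact hc.2
        _ = ε := by field_simp
    linarith
  have h3 := (measureReal_mono (μ := P) hsub).trans (measureReal_union_le _ _)
  linarith [h1 n]

end StochasticOrders

/-! ### Central limit theorem, stochastic boundedness and law of large numbers for sample means. -/

section EmpiricalMeans

variable {Ω : Type*} [MeasurableSpace Ω]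

/-- The scaled deviation `√n (n⁻¹ ∑ f(Xᵢ) - ∫ f dν)` of an empirical mean. -/
noncomputable def scaledMean (ν : Measure ℝ) (X : ℕ → Ω → ℝ) (f : ℝ → ℝ) (n : ℕ) (ω : Ω) : ℝ :=
  √(n : ℝ) * ((1 / (n : ℝ)) * ∑ i ∈ Finset.range n, f (X i ω) - ∫ x, f x ∂ν)

variable {P : Measure Ω} [IsProbabilityMeasure P] {ν : Measure ℝ} {X : ℕ → Ω → ℝ}

omit [MeasurableSpace Ω] in
lemma scaledMean_eq (f : ℝ → ℝ) (n : ℕ) (ω : Ω) : scaledMean ν X f n ω =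
    (√(n : ℝ))⁻¹ * (∑ i ∈ Finset.range n, f (X i ω) - n * ∫ x, f x ∂ν) := by
  rcases n.eq_zero_or_pos with rfl | hn
  · simp [scaledMean]
  · have h : (0 : ℝ) < n := by exact_mod_cast hn
    have h2 : √(n : ℝ) ≠ 0 := (Real.sqrt_pos.2 h).ne'
    have h3 : √(n : ℝ) * √(n : ℝ) = n := Real.mul_self_sqrt h.le
    rw [scaledMean]
    field_simp
    rw [pow_two, h3]

variable (hindep : iIndepFun X P) (hlaw : ∀ i, HasLaw (X i) ν P)
include hlaw

omit [IsProbabilityMeasure P] in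
lemma integral_comp_of_hasLaw {f : ℝ → ℝ} (hf : Measurable f) (i : ℕ) :
    ∫ ω, f (X i ω) ∂P = ∫ x, f x ∂ν := by
  rw [← (hlaw i).map_eq, integral_map (hlaw i).aemeasurable hf.aestronglyMeasurable]

omit [IsProbabilityMeasure P] in
lemma variance_comp_of_hasLaw {f : ℝ → ℝ} (hf : Measurable f) (i : ℕ) :
    Var[fun ω => f (X i ω); P] = Var[f; ν] := by
  rw [← (hlaw i).map_eq, variance_map (by fun_prop) (hlaw i).aemeasurable]
  rfl

omit [IsProbabilityMeasure P] in
lemma memLp_comp_of_hasLaw {f : ℝ → ℝ} (hL : MemLp f 2 ν) (i : ℕ) :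
    MemLp (fun ω => f (X i ω)) 2 P := by
  rw [← (hlaw i).map_eq] at hL
  exact hL.comp_of_map (hlaw i).aemeasurable

include hindep

/-- The central limit theorem for `f(Xᵢ)`. -/
lemma asympNormal_scaledMean {f : ℝ → ℝ} (hf : Measurable f) (hL : MemLp f 2 ν) :
    AsympNormal P (scaledMean ν X f) (Var[f; ν]) := by
  refine ⟨variance_nonneg _ _, ?_⟩
  have hid : ∀ i, IdentDistrib (fun ω => f (X i ω)) (fun ω => f (X 0 ω)) P P := fun i =>
    IdentDistrib.comp ⟨(hlaw i).aemeasurable, (hlaw 0).aemeasurable, by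
      rw [(hlaw i).map_eq, (hlaw 0).map_eq]⟩ hf
  have h := tendstoInDistribution_inv_sqrt_mul_sum_sub (P := P) (X := fun i ω => f (X i ω))
    (Y := (id : ℝ → ℝ)) (P' := gaussianReal 0 Var[fun ω => f (X 0 ω); P].toNNReal)
    ⟨aemeasurable_id, Measure.map_id⟩ (memLp_comp_of_hasLaw hlaw hL 0)
    (hindep.comp (fun _ => f) fun _ => hf) hid
  simp only [variance_comp_of_hasLaw hlaw hf, integral_comp_of_hasLaw hlaw hf] at h
  convert h using 2 with n
  ext ω
  exact scaledMean_eq f n ω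

/-- Slutsky's lemma; all four limit laws are obtained from it by exhibiting a suitable `f`. -/
lemma AsympNormal.of_isLittleOP_sub {f : ℝ → ℝ} (hf : Measurable f) (hL : MemLp f 2 ν)
    {T : ℕ → Ω → ℝ} (hT : ∀ n, AEMeasurable (T n) P)
    (h : IsLittleOP P fun n ω => T n ω - scaledMean ν X f n ω) :
    AsympNormal P T (Var[f; ν]) := by
  obtain ⟨h0, h1⟩ := asympNormal_scaledMean hindep hlaw hf hL
  exact ⟨h0, tendstoInDistribution_of_tendstoInMeasure_sub T _ h1 h hT⟩

/-- Chebyshev's inequality, as the variance of the scaled mean is at most that of `f` for every `n`.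
-/
lemma isBigOP_scaledMean {f : ℝ → ℝ} (hf : Measurable f) (hL : MemLp f 2 ν) :
    IsBigOP P (scaledMean ν X f) := by
  have hν : IsProbabilityMeasure ν := by
    rw [← (hlaw 0).map_eq]
    exact Measure.isProbabilityMeasure_map (hlaw 0).aemeasurable
  have hLi := memLp_comp_of_hasLaw hlaw hL
  intro ε hε
  set v := Var[f; ν] with hv
  have hv0 : 0 ≤ v := variance_nonneg _ _
  -- Chebyshev needs `v / M ^ 2 ≤ ε`; the added `1` keeps `M` positive when `v = 0`.
  set M := √(v / ε) + 1 with hM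
  have hM0 : 0 < M := by positivity
  have hMv : v / M ^ 2 ≤ ε := by
    have h1 : v / ε ≤ M ^ 2 := by
      calc v / ε = √(v / ε) ^ 2 := (Real.sq_sqrt (by positivity)).symm
        _ ≤ M ^ 2 := by gcongr; linarith
    rw [div_le_iff₀ hε] at h1
    rw [div_le_iff₀ (by positivity)]
    linarith
  refine ⟨M, hM0, fun n => ?_⟩
  have hsum : MemLp (fun ω => ∑ i ∈ Finset.range n, f (X i ω)) 2 P :=
    memLp_finsetSum _ fun i _ => hLi i
  have hS : scaledMean ν X f n =
      fun ω => (√(n : ℝ))⁻¹ * (∑ i ∈ Finset.range n, f (X i ω) - n * ∫ x, f x ∂ν) :=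
    funext fun ω => scaledMean_eq f n ω
  have hSL : MemLp (scaledMean ν X f n) 2 P := by
    rw [hS]
    exact (hsum.sub (memLp_const _)).const_mul _
  have hmean : ∫ ω, scaledMean ν X f n ω ∂P = 0 := by
    rw [hS, integral_const_mul, integral_sub (hsum.integrable one_le_two) (integrable_const _),
      integral_finsetSum _ fun i _ => (hLi i).integrable one_le_two]
    simp [integral_comp_of_hasLaw hlaw hf]
  have hvar : Var[scaledMean ν X f n; P] ≤ v := by
    have h1 : Var[fun ω => ∑ i ∈ Finset.range n, f (X i ω); P] = n * v := by
      have h2 := IndepFun.variance_sum (X := fun i ω => f (X i ω)) (s := Finset.range n)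
        (fun i _ => hLi i) fun i _ j _ hij => (hindep.indepFun hij).comp hf hf
      rw [← Finset.sum_fn, h2]
      simp [variance_comp_of_hasLaw hlaw hf, hv]
    rw [hS, variance_const_mul, variance_sub_const hsum.aestronglyMeasurable, h1]
    rcases n.eq_zero_or_pos with rfl | hn
    · simpa using hv0
    · have h : (0 : ℝ) < n := by exact_mod_cast hn
      rw [inv_pow, Real.sq_sqrt h.le]
      field_simp
      exact le_rfl
  have hcheb := meas_ge_le_variance_div_sq hSL hM0
  rw [hmean] at hcheb
  simp only [sub_zero] at hcheb
  have := ENNReal.toReal_mono ENNReal.ofReal_ne_top hcheb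
  rw [ENNReal.toReal_ofReal (by have := variance_nonneg (scaledMean ν X f n) P; positivity)] at this
  refine this.trans (le_trans ?_ hMv)
  gcongr

/-- The weak law of large numbers for `f(Xᵢ)`. -/
lemma isLittleOP_mean_sub {f : ℝ → ℝ} (hf : Measurable f) (hL : MemLp f 2 ν) :
    IsLittleOP P fun n ω =>
      (1 / (n : ℝ)) * ∑ i ∈ Finset.range n, f (X i ω) - ∫ x, f x ∂ν := by
  -- With second moments the law of large numbers is just the `O_P(1)` scaled mean divided by `√n`.
  have h1 : IsLittleOP P fun (n : ℕ) (_ : Ω) => (√(n : ℝ))⁻¹ := by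
    rw [isLittleOP_iff]
    intro ε hε
    have ht : Tendsto (fun n : ℕ => (√(n : ℝ))⁻¹) atTop (nhds 0) :=
      tendsto_inv_atTop_zero.comp (Real.tendsto_sqrt_atTop.comp tendsto_natCast_atTop_atTop)
    refine tendsto_const_nhds.congr' ?_
    filter_upwards [ht.eventually_lt_const hε] with n hn
    have : ¬ ε ≤ |(√(n : ℝ))⁻¹| := by
      rw [abs_of_nonneg (by positivity)]
      exact hn.not_ge
    rw [show {ω : Ω | ε ≤ |(√(n : ℝ))⁻¹|} = ∅ from eq_empty_of_forall_notMem fun _ => this,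
      measureReal_empty]
  refine ((isBigOP_scaledMean hindep hlaw hf hL).mul_isLittleOP h1).mono ?_
  filter_upwards [eventually_gt_atTop 0] with n hn ω
  have h : (0 : ℝ) < n := by exact_mod_cast hn
  have h2 : √(n : ℝ) ≠ 0 := (Real.sqrt_pos.2 h).ne'
  rw [scaledMean, mul_right_comm, mul_inv_cancel₀ h2, one_mul]

end EmpiricalMeans

/-! ### The empirical measure as a probability measure. -/

section EmpiricalMeasure

/-- The empirical measure of the first `n` terms of a sequence. -/
noncomputable def empiricalMeasure (n : ℕ) (x : ℕ → ℝ) : Measure ℝ :=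
  (n : ENNReal)⁻¹ • ∑ i ∈ Finset.range n, Measure.dirac (x i)

variable {n : ℕ} (hn : 0 < n) (x : ℕ → ℝ)
include hn

lemma isProbabilityMeasure_empiricalMeasure : IsProbabilityMeasure (empiricalMeasure n x) := by
  refine ⟨?_⟩
  simp only [empiricalMeasure, Measure.smul_apply, Measure.finsetSum_apply, measure_univ,
    Finset.sum_const, Finset.card_range, smul_eq_mul, nsmul_eq_mul, mul_one]
  exact ENNReal.inv_mul_cancel (by simpa using hn.ne') (by simp)

lemma integrable_empiricalMeasure (f : ℝ → ℝ) : Integrable f (empiricalMeasure n x) := by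
  refine Integrable.smul_measure ?_ (by simpa using hn.ne')
  exact integrable_finsetSum_measure.2 fun i _ => integrable_dirac (by simp)

omit hn in
lemma integral_empiricalMeasure (f : ℝ → ℝ) :
    ∫ y, f y ∂(empiricalMeasure n x) = (1 / (n : ℝ)) * ∑ i ∈ Finset.range n, f (x i) := by
  rw [empiricalMeasure, integral_smul_measure,
    integral_finsetSum_measure fun i _ => integrable_dirac (by simp)]
  simp

lemma empiricalMeasure_real {s : Set ℝ} (hs : MeasurableSet s) :
    (empiricalMeasure n x).real s =
      (1 / (n : ℝ)) * ∑ i ∈ Finset.range n, s.indicator (fun _ => (1 : ℝ)) (x i) := by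
  have := isProbabilityMeasure_empiricalMeasure hn x
  rw [← integral_empiricalMeasure, integral_indicator hs]
  simp

/-- This makes every result on quantiles of a probability measure available for the sample,
pointwise in `ω`, as soon as `n > 0`. -/
lemma cdf_empiricalMeasure {Ω : Type*} (X : ℕ → Ω → ℝ) (ω : Ω) :
    (cdf (empiricalMeasure n fun i => X i ω) : ℝ → ℝ) = empiricalCDF X n ω := by
  have := isProbabilityMeasure_empiricalMeasure hn fun i => X i ω
  ext y
  rw [cdf_eq_real, empiricalMeasure_real hn _ measurableSet_Iic, empiricalCDF]
  simp [indicator]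

end EmpiricalMeasure

/-! ### Sample versions of the tail integral identities. -/

section EmpiricalFunctionals

variable {Ω : Type*} (X : ℕ → Ω → ℝ) {n : ℕ} {p : ℝ}

lemma empiricalCDF_eq_mean (n : ℕ) (ω : Ω) (y : ℝ) : empiricalCDF X n ω y =
    (1 / (n : ℝ)) * ∑ i ∈ Finset.range n, (Iic y).indicator (fun _ => (1 : ℝ)) (X i ω) := by
  simp [empiricalCDF, indicator]

lemma empiricalCDF_zero (ω : Ω) : empiricalCDF X 0 ω = fun _ => 0 := by
  ext y
  simp [empiricalCDF]

variable (hn : 0 < n) (ω : Ω)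
include hn

lemma quantileMean_empiricalCDF : quantileMean (empiricalCDF X n ω) =
    (1 / (n : ℝ)) * ∑ i ∈ Finset.range n, X i ω := by
  have := isProbabilityMeasure_empiricalMeasure hn fun i => X i ω
  rw [← cdf_empiricalMeasure hn X ω, quantileMean_cdf, integral_empiricalMeasure]

lemma intervalIntegrable_quantile_empiricalCDF :
    IntervalIntegrable (quantile (empiricalCDF X n ω)) volume 0 1 := by
  have := isProbabilityMeasure_empiricalMeasure hn fun i => X i ω
  rw [← cdf_empiricalMeasure hn X ω]
  exact intervalIntegrable_quantile _ (integrable_empiricalMeasure hn _ _)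

variable (hp : p ∈ Ioo (0 : ℝ) 1)
include hp

lemma quantile_empiricalCDF_le_iff (y : ℝ) :
    quantile (empiricalCDF X n ω) p ≤ y ↔ p ≤ empiricalCDF X n ω y := by
  rw [← cdf_empiricalMeasure hn X ω]
  exact quantile_cdf_le_iff _ hp y

lemma integral_quantile_empiricalCDF_upper :
    ∫ u in p..1, quantile (empiricalCDF X n ω) u = (1 - p) * quantile (empiricalCDF X n ω) p +
      (1 / (n : ℝ)) * ∑ i ∈ Finset.range n, max (X i ω - quantile (empiricalCDF X n ω) p) 0 := by
  have := isProbabilityMeasure_empiricalMeasure hn fun i => X i ω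
  rw [← cdf_empiricalMeasure hn X ω,
    integral_quantile_upper _ hp (integrable_empiricalMeasure hn _ _), integral_empiricalMeasure]

/-- The lower and the upper tail integral add up to the mean. -/
lemma integral_quantile_empiricalCDF_lower :
    ∫ u in (0 : ℝ)..p, quantile (empiricalCDF X n ω) u =
      (1 / (n : ℝ)) * ∑ i ∈ Finset.range n, X i ω - ∫ u in p..1, quantile (empiricalCDF X n ω) u := by
  have h := intervalIntegrable_quantile_empiricalCDF X hn ω
  have hadd := intervalIntegral.integral_add_adjacent_intervals (a := 0) (b := p) (c := 1)
    (μ := volume) (f := quantile (empiricalCDF X n ω)) (h.mono_set ?_) (h.mono_set ?_)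
  · rw [← quantileMean_empiricalCDF X hn ω, quantileMean, ← hadd]
    ring
  · rw [uIcc_of_le hp.1.le, uIcc_of_le zero_le_one]
    exact Icc_subset_Icc_right hp.2.le
  · rw [uIcc_of_le hp.2.le, uIcc_of_le zero_le_one]
    exact Icc_subset_Icc_left hp.1.le

lemma abs_excess_sub_integral_quantile_empiricalCDF_le (c a b : ℝ) (ha : p ≤ a) (hb : b ≤ p) :
    |(1 - p) * c + (1 / (n : ℝ)) * ∑ i ∈ Finset.range n, max (X i ω - c) 0 -
        ∫ u in p..1, quantile (empiricalCDF X n ω) u| ≤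
      |quantile (empiricalCDF X n ω) p - c| *
        (|(1 / (n : ℝ)) * ∑ i ∈ Finset.range n, (Iic c).indicator (fun _ => (1 : ℝ)) (X i ω) - a| +
        |(1 / (n : ℝ)) * ∑ i ∈ Finset.range n, (Iio c).indicator (fun _ => (1 : ℝ)) (X i ω) - b|) := by
  have := isProbabilityMeasure_empiricalMeasure hn fun i => X i ω
  have h := abs_quantile_excess_sub_le (empiricalMeasure n fun i => X i ω) hp c a b ha hb
    fun z => integrable_empiricalMeasure hn _ _
  rw [integral_empiricalMeasure, integral_empiricalMeasure, cdf_empiricalMeasure hn X ω,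
    empiricalMeasure_real hn _ measurableSet_Iio, empiricalCDF_eq_mean] at h
  rwa [integral_quantile_empiricalCDF_upper X hn ω hp]

end EmpiricalFunctionals

/-! ### Measurability of the empirical functionals. -/

section Measurability

variable {Ω : Type*} [MeasurableSpace Ω] {P : Measure Ω} {X : ℕ → Ω → ℝ}
  (hX : ∀ i, AEMeasurable (X i) P) {p : ℝ} (hp : p ∈ Ioo (0 : ℝ) 1) (n : ℕ)

-- The Galois connection turns sublevel sets of the sample quantile into superlevel sets of
-- `F_n(y)`. Working on the sequence space gives genuine measurability, which then composes with the
-- merely a.e. measurable `X i`. For `n = 0` the empirical cdf is zero and the quantile is a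
-- constant.
include hp in
lemma measurable_quantile_empiricalCDF :
    Measurable fun x : ℕ → ℝ => quantile (empiricalCDF (fun i y => y i) n x) p := by
  rcases n.eq_zero_or_pos with rfl | hn
  · simp only [empiricalCDF_zero, measurable_const]
  · refine measurable_of_Iic fun y => ?_
    have : (fun x : ℕ → ℝ => quantile (empiricalCDF (fun i y => y i) n x) p) ⁻¹' Iic y =
        {x | p ≤ empiricalCDF (fun i y => y i) n x y} := by
      ext x
      exact quantile_empiricalCDF_le_iff (fun i (y : ℕ → ℝ) => y i) hn x hp y
    rw [this]
    refine measurableSet_le measurable_const ?_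
    unfold empiricalCDF
    refine (Finset.measurable_fun_sum _ fun i _ => ?_).const_mul _
    exact Measurable.ite (measurableSet_le (measurable_pi_apply i) measurable_const)
      measurable_const measurable_const

include hX

lemma aemeasurable_mean_comp {f : ℝ → ℝ} (hf : Measurable f) :
    AEMeasurable (fun ω => (1 / (n : ℝ)) * ∑ i ∈ Finset.range n, f (X i ω)) P :=
  (Finset.aemeasurable_fun_sum _ fun i _ => hf.comp_aemeasurable (hX i)).const_mul _

lemma aemeasurable_quantileMean_empiricalCDF :
    AEMeasurable (fun ω => quantileMean (empiricalCDF X n ω)) P := by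
  rcases n.eq_zero_or_pos with rfl | hn
  · simp only [empiricalCDF_zero, aemeasurable_const]
  · simp only [quantileMean_empiricalCDF X hn]
    exact aemeasurable_mean_comp hX n measurable_id

include hp

lemma aemeasurable_quantile_empiricalCDF :
    AEMeasurable (fun ω => quantile (empiricalCDF X n ω) p) P :=
  (measurable_quantile_empiricalCDF hp n).comp_aemeasurable (aemeasurable_pi_lambda _ hX)

lemma aemeasurable_integral_quantile_upper :
    AEMeasurable (fun ω => ∫ u in p..1, quantile (empiricalCDF X n ω) u) P := by
  rcases n.eq_zero_or_pos with rfl | hn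
  · simp only [empiricalCDF_zero, aemeasurable_const]
  · have hq := aemeasurable_quantile_empiricalCDF hX hp n
    simp only [integral_quantile_empiricalCDF_upper X hn _ hp]
    exact (hq.const_mul _).add ((Finset.aemeasurable_fun_sum _ fun i _ =>
      ((hX i).sub hq).max aemeasurable_const).const_mul _)

lemma aemeasurable_integral_quantile_lower :
    AEMeasurable (fun ω => ∫ u in (0 : ℝ)..p, quantile (empiricalCDF X n ω) u) P := by
  rcases n.eq_zero_or_pos with rfl | hn
  · simp only [empiricalCDF_zero, aemeasurable_const]
  · simp only [integral_quantile_empiricalCDF_lower X hn _ hp]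
    exact (aemeasurable_mean_comp hX n measurable_id).sub
      (aemeasurable_integral_quantile_upper hX hp n)

end Measurability

/-! ### Consistency of the sample quantile and negligibility of the remainder. -/

section Remainder

variable {Ω : Type*} [MeasurableSpace Ω] {P : Measure Ω} [IsProbabilityMeasure P]
  {ν : Measure ℝ} [IsProbabilityMeasure ν] {X : ℕ → Ω → ℝ}
  (hindep : iIndepFun X P) (hlaw : ∀ i, HasLaw (X i) ν P)
  {p : ℝ} (hp : p ∈ Ioo (0 : ℝ) 1) (hcont : ContinuousAt (quantile (cdf ν)) p)

-- By continuity some `u > p` still has `F⁻¹(u) < y`, whence `p < u ≤ F(y)`. This strict inequality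
-- is what continuity of `F⁻¹` contributes.
omit [IsProbabilityMeasure ν] in
include hp hcont in
lemma lt_cdf_of_quantile_lt {y : ℝ} (hy : quantile (cdf ν) p < y) : p < cdf ν y := by
  have h1 : ∀ᶠ u in nhdsWithin p (Ioi p), quantile (cdf ν) u < y :=
    (hcont.eventually_lt_const hy).filter_mono nhdsWithin_le_nhds
  obtain ⟨u, hu1, hu2⟩ := (h1.and (Ioo_mem_nhdsGT hp.2)).exists
  exact hu2.1.trans_le ((quantile_cdf_le_iff ν ⟨hp.1.trans hu2.1, hu2.2⟩ y).1 hu1.le)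

omit [IsProbabilityMeasure P] in
lemma memLp_indicator_one {s : Set ℝ} (hs : MeasurableSet s) :
    MemLp (s.indicator fun _ => (1 : ℝ)) 2 ν :=
  (memLp_const (1 : ℝ)).indicator hs

include hindep hlaw

lemma isLittleOP_empiricalCDF_sub (y : ℝ) :
    IsLittleOP P fun n ω => empiricalCDF X n ω y - cdf ν y := by
  have h := isLittleOP_mean_sub hindep hlaw (measurable_const.indicator (measurableSet_Iic (a := y)))
    (memLp_indicator_one (ν := ν) (measurableSet_Iic (a := y)))
  simp only [← empiricalCDF_eq_mean, integral_indicator measurableSet_Iic] at h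
  simpa [cdf_eq_real] using h

include hp hcont

/-- Consistency of the empirical quantile at a continuity point. -/
lemma isLittleOP_quantile_sub :
    IsLittleOP P fun n ω => quantile (empiricalCDF X n ω) p - quantile (cdf ν) p := by
  rw [isLittleOP_iff]
  intro ε hε
  set c := quantile (cdf ν) p with hc
  -- The Galois connection needs `q_n` strictly above the test point to give `F_n < p`, hence `ε /
  -- 2` on the right; on the left `q_n ≤ c - ε` can be used as it is.
  have h1 : p < cdf ν (c + ε / 2) := lt_cdf_of_quantile_lt hp hcont (by linarith)
  have h2 : cdf ν (c - ε) < p := not_le.1 (mt (quantile_cdf_le_iff ν hp _).2 (by linarith))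
  have ht := ((isLittleOP_iff.1 (isLittleOP_empiricalCDF_sub hindep hlaw (c + ε / 2))) _
    (sub_pos.2 h1)).add ((isLittleOP_iff.1 (isLittleOP_empiricalCDF_sub hindep hlaw (c - ε))) _
    (sub_pos.2 h2))
  rw [add_zero] at ht
  refine squeeze_zero' (Eventually.of_forall fun n => measureReal_nonneg) ?_ ht
  filter_upwards [eventually_gt_atTop 0] with n hn
  refine (measureReal_mono fun ω hω => ?_).trans (measureReal_union_le _ _)
  simp only [mem_union, mem_ofPred_eq] at hω ⊢
  rcases le_abs'.1 hω with h | h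
  · right
    have := (quantile_empiricalCDF_le_iff X hn ω hp (c - ε)).1 (by linarith)
    exact le_trans (by linarith) (le_abs_self _)
  · left
    have : empiricalCDF X n ω (c + ε / 2) < p :=
      not_le.1 (mt (quantile_empiricalCDF_le_iff X hn ω hp (c + ε / 2)).2 (by linarith))
    exact le_trans (by linarith) (neg_le_abs _)

/-- Replacing the empirical quantile by the true one in the empirical tail integral costs
`o_P(n^{-1/2})`. -/
lemma isLittleOP_sqrt_mul_excess_sub :
    IsLittleOP P fun n ω => √(n : ℝ) * ((1 - p) * quantile (cdf ν) p +
      (1 / (n : ℝ)) * ∑ i ∈ Finset.range n, max (X i ω - quantile (cdf ν) p) 0 -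
        ∫ u in p..1, quantile (empiricalCDF X n ω) u) := by
  set c := quantile (cdf ν) p with hc
  -- Both `Iic c` and `Iio c` are needed because `F` may jump at `c`; each empirical frequency is
  -- centred at its own limit.
  have hB : ∀ s : Set ℝ, MeasurableSet s →
      IsBigOP P fun n ω => |scaledMean ν X (s.indicator fun _ => (1 : ℝ)) n ω| := fun s hs =>
    (isBigOP_scaledMean hindep hlaw (measurable_const.indicator hs) (memLp_indicator_one hs)).abs
  refine (((hB (Iic c) measurableSet_Iic).add (hB (Iio c) measurableSet_Iio)).mul_isLittleOP
    (isLittleOP_quantile_sub hindep hlaw hp hcont)).mono ?_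
  filter_upwards [eventually_gt_atTop 0] with n hn ω
  have h := abs_excess_sub_integral_quantile_empiricalCDF_le X hn ω hp c (cdf ν c)
    (ν.real (Iio c)) (le_cdf_quantile ν hp) (measureReal_Iio_quantile_le ν hp)
  have hI : ∀ s : Set ℝ, MeasurableSet s → ∫ x, s.indicator (fun _ => (1 : ℝ)) x ∂ν = ν.real s :=
    fun s hs => by rw [integral_indicator hs]; simp
  have h0 := Real.sqrt_nonneg (n : ℝ)
  have habs : ∀ u v : ℝ, |(|u| + |v|)| = |u| + |v| := fun u v => abs_of_nonneg (by positivity)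
  rw [abs_mul, abs_mul, abs_of_nonneg h0,
    habs, scaledMean, scaledMean,
    hI _ measurableSet_Iic, hI _ measurableSet_Iio, abs_mul, abs_mul, abs_of_nonneg h0, ← mul_add,
    ← cdf_eq_real, mul_assoc, mul_comm (_ + _)]
  exact mul_le_mul_of_nonneg_left h h0

end Remainder

/-! ### Second moments of excesses and shortfalls. -/

section Moments

variable {ν : Measure ℝ}

lemma memLp_max_neg (hL : MemLp (fun x : ℝ => x) 2 ν) : MemLp (fun x : ℝ => max (-x) 0) 2 ν := by
  refine hL.mono (by fun_prop) (ae_of_all _ fun x => ?_)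
  rw [Real.norm_eq_abs, Real.norm_eq_abs, abs_of_nonneg (le_max_right _ _)]
  exact max_le (neg_le_abs x) (abs_nonneg x)

variable [IsProbabilityMeasure ν]

lemma memLp_max_sub (hL : MemLp (fun x : ℝ => max x 0) 2 ν) (c : ℝ) :
    MemLp (fun x : ℝ => max (x - c) 0) 2 ν := by
  refine (hL.add (memLp_const |c|)).mono' (by fun_prop) (ae_of_all _ fun x => ?_)
  rw [Real.norm_eq_abs, abs_of_nonneg (le_max_right _ _)]
  change max (x - c) 0 ≤ max x 0 + |c|
  exact max_le (by linarith [le_max_left x 0, neg_le_abs c]) (by positivity)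

lemma memLp_max_sub_rev (hL : MemLp (fun x : ℝ => max (-x) 0) 2 ν) (c : ℝ) :
    MemLp (fun x : ℝ => max (c - x) 0) 2 ν := by
  refine (hL.add (memLp_const |c|)).mono' (by fun_prop) (ae_of_all _ fun x => ?_)
  rw [Real.norm_eq_abs, abs_of_nonneg (le_max_right _ _)]
  change max (c - x) 0 ≤ max (-x) 0 + |c|
  exact max_le (by linarith [le_max_left (-x) 0, le_abs_self c]) (by positivity)

end Moments

/-! ### Expansions of tail integrals and the two tail-values-at-risk. -/

section TailIntegrals

variable {Ω : Type*} [MeasurableSpace Ω] {P : Measure Ω} [IsProbabilityMeasure P]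
  {ν : Measure ℝ} [IsProbabilityMeasure ν] {X : ℕ → Ω → ℝ}
  (hindep : iIndepFun X P) (hlaw : ∀ i, HasLaw (X i) ν P)
  {p : ℝ} (hp : p ∈ Ioo (0 : ℝ) 1) (hcont : ContinuousAt (quantile (cdf ν)) p)

omit [MeasurableSpace Ω] [IsProbabilityMeasure ν] in
lemma scaledMean_const_mul (a : ℝ) (f : ℝ → ℝ) (n : ℕ) (ω : Ω) :
    scaledMean ν X (fun x => a * f x) n ω = a * scaledMean ν X f n ω := by
  rw [scaledMean, scaledMean, ← Finset.mul_sum, integral_const_mul]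
  ring

include hindep hlaw hp hcont

/-- Expansion of the lower tail integral of the empirical quantile function. -/
lemma isLittleOP_lower_integral
    (hL : MemLp (fun x => max (quantile (cdf ν) p - x) 0) 2 ν) :
    IsLittleOP P fun n ω => √(n : ℝ) * ((∫ u in (0 : ℝ)..p, quantile (empiricalCDF X n ω) u) -
      ∫ u in (0 : ℝ)..p, quantile (cdf ν) u) +
      scaledMean ν X (fun x => max (quantile (cdf ν) p - x) 0) n ω := by
  refine (isLittleOP_sqrt_mul_excess_sub hindep hlaw hp hcont).mono ?_
  filter_upwards [eventually_gt_atTop 0] with n hn ω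
  have hn0 : (n : ℝ) ≠ 0 := by exact_mod_cast hn.ne'
  set c := quantile (cdf ν) p with hc
  -- Summing `x = (x - c)⁺ - (c - x)⁺ + c` identifies the lower remainder with the upper one
  -- exactly. The upper tail enters only through the sample, so the law needs no moment on that
  -- side.
  have h1 : ∑ i ∈ Finset.range n, X i ω = ∑ i ∈ Finset.range n, max (X i ω - c) 0 -
      ∑ i ∈ Finset.range n, max (c - X i ω) 0 + n * c := by
    rw [← Finset.sum_sub_distrib, ← sub_eq_iff_eq_add]
    have : (n : ℝ) * c = ∑ i ∈ Finset.range n, c := by simp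
    rw [this, ← Finset.sum_sub_distrib]
    refine Finset.sum_congr rfl fun i _ => ?_
    rcases max_cases (X i ω - c) 0 with h | h <;> rcases max_cases (c - X i ω) 0 with h' | h' <;>
      linarith
  refine le_of_eq (congrArg _ ?_)
  rw [integral_quantile_empiricalCDF_lower X hn ω hp, integral_quantile_lower ν hp
    (hL.integrable one_le_two), scaledMean, h1]
  field_simp
  ring

/-- Asymptotic normality of the empirical upside tail-value-at-risk. -/
lemma asympNormal_upsideTVaR (hL : MemLp (fun x => max (x - quantile (cdf ν) p) 0) 2 ν) :
    AsympNormal P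
      (fun n ω => √(n : ℝ) * (upsideTVaR (empiricalCDF X n ω) p - upsideTVaR (cdf ν) p))
      ((1 / (1 - p) ^ 2) * Var[fun x => max (x - quantile (cdf ν) p) 0; ν]) := by
  have hX : ∀ i, AEMeasurable (X i) P := fun i => (hlaw i).aemeasurable
  have h := AsympNormal.of_isLittleOP_sub hindep hlaw
    (f := fun x => (1 / (1 - p)) * max (x - quantile (cdf ν) p) 0) (by fun_prop) (hL.const_mul _)
    (T := fun n ω => √(n : ℝ) * (upsideTVaR (empiricalCDF X n ω) p - upsideTVaR (cdf ν) p))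
    (fun n => (((aemeasurable_integral_quantile_upper hX hp n).const_mul _).sub_const _).const_mul
      _) ?_
  · rwa [variance_const_mul, one_div_pow] at h
  · refine ((isLittleOP_sqrt_mul_excess_sub hindep hlaw hp hcont).const_mul
      (-(1 / (1 - p)))).mono (Eventually.of_forall fun n ω => le_of_eq (congrArg _ ?_))
    rw [scaledMean_const_mul, upsideTVaR, upsideTVaR, integral_quantile_upper ν hp
      (hL.integrable one_le_two), scaledMean]
    ring

/-- Asymptotic normality of the empirical downside tail-value-at-risk. -/
lemma asympNormal_downsideTVaR (hL : MemLp (fun x => max (quantile (cdf ν) p - x) 0) 2 ν) :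
    AsympNormal P
      (fun n ω => √(n : ℝ) * (downsideTVaR (empiricalCDF X n ω) p - downsideTVaR (cdf ν) p))
      ((1 / p ^ 2) * Var[fun x => max (quantile (cdf ν) p - x) 0; ν]) := by
  have hX : ∀ i, AEMeasurable (X i) P := fun i => (hlaw i).aemeasurable
  have h := AsympNormal.of_isLittleOP_sub hindep hlaw
    (f := fun x => (-(1 / p)) * max (quantile (cdf ν) p - x) 0) (by fun_prop) (hL.const_mul _)
    (T := fun n ω => √(n : ℝ) * (downsideTVaR (empiricalCDF X n ω) p - downsideTVaR (cdf ν) p))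
    (fun n => (((aemeasurable_integral_quantile_lower hX hp n).const_mul _).sub_const _).const_mul
      _) ?_
  · rwa [variance_const_mul, neg_sq, one_div_pow] at h
  · refine ((isLittleOP_lower_integral hindep hlaw hp hcont hL).const_mul (1 / p)).mono
      (Eventually.of_forall fun n ω => le_of_eq (congrArg _ ?_))
    rw [scaledMean_const_mul, downsideTVaR, downsideTVaR]
    ring

end TailIntegrals

/-! ### Lorenz and Gini curves. -/

section LorenzAndGini

variable {ν : Measure ℝ} [IsProbabilityMeasure ν] (hL : MemLp (fun x : ℝ => x) 2 ν)
  {p : ℝ} (hp : p ∈ Ioo (0 : ℝ) 1)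

include hL

lemma memLp_shortfall (c : ℝ) : MemLp (fun x : ℝ => max (c - x) 0) 2 ν :=
  memLp_max_sub_rev (memLp_max_neg hL) c

lemma lorenzInfluence_cdf (t : ℝ) : lorenzInfluence (cdf ν) p t =
    (1 / quantileMean (cdf ν)) *
      (max (quantile (cdf ν) p - t) 0 - ∫ x, max (quantile (cdf ν) p - x) 0 ∂ν) +
    (lorenzCurve (cdf ν) p / quantileMean (cdf ν)) * (t - ∫ x, x ∂ν) := by
  rw [lorenzInfluence, (integral_centredIndicator ν _ (memLp_shortfall hL _) t).2,
    ← quantileMean_cdf]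

lemma measurable_lorenzInfluence : Measurable (lorenzInfluence (cdf ν) p) := by
  rw [funext (lorenzInfluence_cdf hL)]
  fun_prop

lemma memLp_lorenzInfluence : MemLp (lorenzInfluence (cdf ν) p) 2 ν := by
  rw [funext (lorenzInfluence_cdf hL)]
  exact (((memLp_shortfall hL _).sub (memLp_const _)).const_mul _).add
    ((hL.sub (memLp_const _)).const_mul _)

lemma integral_lorenzInfluence : ∫ t, lorenzInfluence (cdf ν) p t ∂ν = 0 := by
  have h1 := (memLp_shortfall hL (quantile (cdf ν) p)).integrable one_le_two
  have h2 := hL.integrable one_le_two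
  simp only [lorenzInfluence_cdf hL]
  have h3 := h1.sub (integrable_const (∫ x, max (quantile (cdf ν) p - x) 0 ∂ν))
  have h4 := h2.sub (integrable_const (∫ x, x ∂ν))
  refine (integral_add (h3.const_mul _) (h4.const_mul _)).trans ?_
  rw [integral_const_mul, integral_const_mul, integral_sub' h1 (integrable_const _),
    integral_sub' h2 (integrable_const _)]
  simp

include hp in
lemma one_sub_giniCurve_cdf (hμ : quantileMean (cdf ν) ≠ 0) :
    1 - giniCurve (cdf ν) p = lorenzCurve (cdf ν) (1 - p) + lorenzCurve (cdf ν) p := by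
  have h := intervalIntegrable_quantile ν (hL.integrable one_le_two)
  have hadd := intervalIntegral.integral_add_adjacent_intervals (a := 0) (b := 1 - p) (c := 1)
    (μ := volume) (f := quantile (cdf ν)) (h.mono_set ?_) (h.mono_set ?_)
  · rw [giniCurve, lorenzCurve, lorenzCurve, eq_sub_of_add_eq' hadd, ← quantileMean]
    field_simp
    ring
  · rw [uIcc_of_le (by linarith [hp.2]), uIcc_of_le zero_le_one]
    exact Icc_subset_Icc_right (by linarith [hp.1])
  · rw [uIcc_of_le (by linarith [hp.1]), uIcc_of_le zero_le_one]
    exact Icc_subset_Icc_left (by linarith [hp.2])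

include hp in
lemma giniInfluence_cdf (hμ : quantileMean (cdf ν) ≠ 0) : giniInfluence (cdf ν) p =
    fun t => lorenzInfluence (cdf ν) (1 - p) t + lorenzInfluence (cdf ν) p t := by
  ext t
  rw [giniInfluence, one_sub_giniCurve_cdf hL hp hμ, lorenzInfluence, lorenzInfluence]
  ring

variable {Ω : Type*} [MeasurableSpace Ω] {P : Measure Ω} [IsProbabilityMeasure P] {X : ℕ → Ω → ℝ}

omit [MeasurableSpace Ω] in
lemma scaledMean_lorenzInfluence (n : ℕ) (ω : Ω) :
    scaledMean ν X (lorenzInfluence (cdf ν) p) n ω =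
      (1 / √(n : ℝ)) * ∑ i ∈ Finset.range n, lorenzInfluence (cdf ν) p (X i ω) := by
  rw [scaledMean_eq, integral_lorenzInfluence hL]
  simp

-- Splits the influence term into the fluctuations of the numerator and of the denominator of the
-- Lorenz ratio.
omit [MeasurableSpace Ω] in
lemma scaledMean_lorenzInfluence_eq_add (n : ℕ) (ω : Ω) :
    scaledMean ν X (lorenzInfluence (cdf ν) p) n ω =
      (1 / quantileMean (cdf ν)) *
        scaledMean ν X (fun x => max (quantile (cdf ν) p - x) 0) n ω +
      (lorenzCurve (cdf ν) p / quantileMean (cdf ν)) * scaledMean ν X (fun x => x) n ω := by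
  rw [scaledMean_lorenzInfluence hL, scaledMean_eq, scaledMean_eq]
  simp only [lorenzInfluence_cdf hL, Finset.sum_add_distrib, ← Finset.mul_sum,
    Finset.sum_sub_distrib, Finset.sum_const, Finset.card_range, nsmul_eq_mul, one_div]
  ring

variable (hindep : iIndepFun X P) (hlaw : ∀ i, HasLaw (X i) ν P)
include hindep hlaw

lemma isLittleOP_quantileMean_sub :
    IsLittleOP P fun n ω => quantileMean (empiricalCDF X n ω) - quantileMean (cdf ν) := by
  refine (isLittleOP_mean_sub hindep hlaw measurable_id hL).mono ?_
  filter_upwards [eventually_gt_atTop 0] with n hn ω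
  rw [quantileMean_empiricalCDF X hn, quantileMean_cdf]
  exact le_rfl

include hp

/-- The linear expansion of the empirical Lorenz curve. -/
lemma isLittleOP_lorenzCurve (hμ : quantileMean (cdf ν) ≠ 0)
    (hcont : ContinuousAt (quantile (cdf ν)) p) :
    IsLittleOP P fun n ω =>
      √(n : ℝ) * (lorenzCurve (empiricalCDF X n ω) p - lorenzCurve (cdf ν) p) +
        scaledMean ν X (lorenzInfluence (cdf ν) p) n ω := by
  have hD := isLittleOP_quantileMean_sub hL hindep hlaw
  have hr := isLittleOP_lower_integral hindep hlaw hp hcont (memLp_shortfall hL _)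
  have hY := isBigOP_scaledMean hindep hlaw (measurable_lorenzInfluence hL (p := p))
    (memLp_lorenzInfluence hL)
  refine ((hr.add (hY.mul_isLittleOP hD)).const_mul (2 / quantileMean (cdf ν))).of_abs_le hD
    (half_pos (abs_pos.2 hμ)) ?_
  filter_upwards [eventually_gt_atTop 0] with n hn ω hlt
  have hd : scaledMean ν X (fun x => x) n ω =
      √(n : ℝ) * (quantileMean (empiricalCDF X n ω) - quantileMean (cdf ν)) := by
    rw [quantileMean_empiricalCDF X hn, quantileMean_cdf, scaledMean]
  have hs := scaledMean_lorenzInfluence_eq_add (p := p) (X := X) hL n ω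
  rw [hd] at hs
  set m := quantileMean (empiricalCDF X n ω) with hm
  set μ := quantileMean (cdf ν) with hμ'
  set Y := scaledMean ν X (lorenzInfluence (cdf ν) p) n ω
  set s := scaledMean ν X (fun x => max (quantile (cdf ν) p - x) 0) n ω
  -- On the event `|m - μ| < |μ| / 2` the factor `1 / |m|` is at most `2 / |μ|`, the constant used
  -- above; the complement has vanishing probability.
  have hm2 : |μ| / 2 ≤ |m| := by
    have := abs_sub_abs_le_abs_sub μ m
    rw [abs_sub_comm] at this
    linarith
  have hm0 : m ≠ 0 := abs_pos.1 (lt_of_lt_of_le (half_pos (abs_pos.2 hμ)) hm2)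
  simp only [lorenzCurve, ← hμ', ← hm] at hs ⊢
  set A := ∫ u in (0 : ℝ)..p, quantile (cdf ν) u
  set B := ∫ u in (0 : ℝ)..p, quantile (empiricalCDF X n ω) u
  -- Exact linearisation of the ratio: the error is the lower-tail remainder plus `Y * (m - μ)`, an
  -- `O_P(1)` times an `o_P(1)`.
  have key : √(n : ℝ) * (1 / m * B - 1 / μ * A) + Y =
      1 / m * (√(n : ℝ) * (B - A) + s + Y * (m - μ)) := by
    rw [hs]
    field_simp
    ring
  rw [key, abs_mul, abs_mul]
  refine mul_le_mul_of_nonneg_right ?_ (abs_nonneg _)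
  rw [abs_div, abs_div, abs_one, abs_two, div_le_div_iff₀ (abs_pos.2 hm0) (abs_pos.2 hμ)]
  linarith

lemma asympNormal_lorenzCurve (hμ : quantileMean (cdf ν) ≠ 0)
    (hcont : ContinuousAt (quantile (cdf ν)) p) :
    AsympNormal P
      (fun n ω => √(n : ℝ) * (lorenzCurve (empiricalCDF X n ω) p - lorenzCurve (cdf ν) p))
      (∫ t, lorenzInfluence (cdf ν) p t ^ 2 ∂ν) := by
  have hX : ∀ i, AEMeasurable (X i) P := fun i => (hlaw i).aemeasurable
  have hm := measurable_lorenzInfluence hL (p := p)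
  have h := AsympNormal.of_isLittleOP_sub hindep hlaw
    -- The expansion carries a minus sign, which the variance does not see.
    (f := fun x => (-1) * lorenzInfluence (cdf ν) p x) (hm.const_mul _)
    ((memLp_lorenzInfluence hL).const_mul _)
    (T := fun n ω => √(n : ℝ) * (lorenzCurve (empiricalCDF X n ω) p - lorenzCurve (cdf ν) p))
    (fun n => ((((aemeasurable_quantileMean_empiricalCDF hX n).const_div 1).mul
      (aemeasurable_integral_quantile_lower hX hp n)).sub_const _).const_mul _) ?_
  · rw [variance_const_mul, neg_one_sq, one_mul,
      variance_of_integral_eq_zero hm.aemeasurable (integral_lorenzInfluence hL)] at h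
    exact h
  · refine (isLittleOP_lorenzCurve hL hp hindep hlaw hμ hcont).mono
      (Eventually.of_forall fun n ω => le_of_eq (congrArg _ ?_))
    rw [scaledMean_const_mul]
    ring

/-- The linear expansion of the empirical Gini curve. -/
lemma isLittleOP_giniCurve (hμ : quantileMean (cdf ν) ≠ 0)
    (hcont : ContinuousAt (quantile (cdf ν)) p)
    (hcont' : ContinuousAt (quantile (cdf ν)) (1 - p)) :
    IsLittleOP P fun n ω =>
      √(n : ℝ) * (giniCurve (empiricalCDF X n ω) p - giniCurve (cdf ν) p) -
        (scaledMean ν X (lorenzInfluence (cdf ν) (1 - p)) n ω +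
          scaledMean ν X (lorenzInfluence (cdf ν) p) n ω) := by
  have hp' : 1 - p ∈ Ioo (0 : ℝ) 1 := ⟨by linarith [hp.2], by linarith [hp.1]⟩
  refine (((isLittleOP_lorenzCurve hL hp' hindep hlaw hμ hcont').add
    (isLittleOP_lorenzCurve hL hp hindep hlaw hμ hcont)).const_mul (-1)).of_abs_le
    (isLittleOP_quantileMean_sub hL hindep hlaw) (abs_pos.2 hμ) ?_
  filter_upwards [eventually_gt_atTop 0] with n hn ω hlt
  -- The identity `1 - GC = LC(1-p) + LC(p)` for the sample needs a nonzero sample mean, which holds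
  -- on the event `|m - μ| < |μ|`.
  have hm0 : quantileMean (empiricalCDF X n ω) ≠ 0 := by
    intro h0
    rw [h0, zero_sub, abs_neg] at hlt
    exact hlt.false
  have h1 : giniCurve (empiricalCDF X n ω) p = 1 - lorenzCurve (empiricalCDF X n ω) (1 - p) -
      lorenzCurve (empiricalCDF X n ω) p := by
    have h2 := integral_quantile_empiricalCDF_lower X hn ω hp'
    rw [← quantileMean_empiricalCDF X hn ω] at h2
    rw [giniCurve, lorenzCurve, lorenzCurve, h2]
    field_simp
    ring
  refine le_of_eq (congrArg _ ?_)
  rw [h1, show giniCurve (cdf ν) p = 1 - (lorenzCurve (cdf ν) (1 - p) + lorenzCurve (cdf ν) p) by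
    rw [← one_sub_giniCurve_cdf hL hp hμ]; ring]
  ring

lemma asympNormal_giniCurve (hμ : quantileMean (cdf ν) ≠ 0)
    (hcont : ContinuousAt (quantile (cdf ν)) p)
    (hcont' : ContinuousAt (quantile (cdf ν)) (1 - p)) :
    AsympNormal P
      (fun n ω => √(n : ℝ) * (giniCurve (empiricalCDF X n ω) p - giniCurve (cdf ν) p))
      (∫ t, giniInfluence (cdf ν) p t ^ 2 ∂ν) := by
  have hX : ∀ i, AEMeasurable (X i) P := fun i => (hlaw i).aemeasurable
  have hp' : 1 - p ∈ Ioo (0 : ℝ) 1 := ⟨by linarith [hp.2], by linarith [hp.1]⟩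
  have hm := (measurable_lorenzInfluence hL (p := 1 - p)).add
    (measurable_lorenzInfluence hL (p := p))
  have hM := (memLp_lorenzInfluence hL (p := 1 - p)).add (memLp_lorenzInfluence hL (p := p))
  have h0 : ∫ t, (lorenzInfluence (cdf ν) (1 - p) t + lorenzInfluence (cdf ν) p t) ∂ν = 0 := by
    rw [integral_add ((memLp_lorenzInfluence hL).integrable one_le_two)
      ((memLp_lorenzInfluence hL).integrable one_le_two), integral_lorenzInfluence hL,
      integral_lorenzInfluence hL, add_zero]
  have h := AsympNormal.of_isLittleOP_sub hindep hlaw hm hM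
    (T := fun n ω => √(n : ℝ) * (giniCurve (empiricalCDF X n ω) p - giniCurve (cdf ν) p))
    (fun n => ((((aemeasurable_quantileMean_empiricalCDF hX n).const_div 1).mul
      ((aemeasurable_integral_quantile_upper hX hp' n).sub
        (aemeasurable_integral_quantile_lower hX hp n))).sub_const _).const_mul _) ?_
  · rw [variance_of_integral_eq_zero hm.aemeasurable h0] at h
    rw [giniInfluence_cdf hL hp hμ]
    exact h
  · refine (isLittleOP_giniCurve hL hp hindep hlaw hμ hcont hcont').mono
      (Eventually.of_forall fun n ω => le_of_eq (congrArg _ (congrArg _ ?_)))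
    rw [scaledMean_lorenzInfluence hL, scaledMean_lorenzInfluence hL, scaledMean_eq]
    simp only [Pi.add_apply, h0, Finset.sum_add_distrib]
    ring

end LorenzAndGini

/-! ### Assembly of the four limit theorems. -/

theorem mainTheorem8 {Ω : Type*} [MeasurableSpace Ω] (P : Measure Ω) [IsProbabilityMeasure P]
    (ν : Measure ℝ) [IsProbabilityMeasure ν] (X : ℕ → Ω → ℝ)
    (hindep : iIndepFun X P) (hlaw : ∀ i, HasLaw (X i) ν P)
    (F : ℝ → ℝ) (hF : F = cdf ν)
    (p : ℝ) (hp : p ∈ Ioo (0 : ℝ) 1) (hcont : ContinuousAt (quantile F) p) :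
    -- upside tail-value-at-risk: only the positive part needs a second moment
    (MemLp (fun x : ℝ => max x 0) 2 ν →
      IntervalIntegrable (quantile F) volume p 1 ∧
      IntegrableOn (fun z : ℝ × ℝ => covKernel F z.1 z.2)
        (Ioi (quantile F p) ×ˢ Ioi (quantile F p)) ∧
      AsympNormal P
        (fun n ω => √(n : ℝ) * (upsideTVaR (empiricalCDF X n ω) p - upsideTVaR F p))
        ((1 / (1 - p) ^ 2) *
          ∫ x in Ioi (quantile F p), ∫ y in Ioi (quantile F p), covKernel F x y)) ∧
    -- downside tail-value-at-risk: only the negative part needs a second moment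
    (MemLp (fun x : ℝ => max (-x) 0) 2 ν →
      IntervalIntegrable (quantile F) volume 0 p ∧
      IntegrableOn (fun z : ℝ × ℝ => covKernel F z.1 z.2)
        (Iic (quantile F p) ×ˢ Iic (quantile F p)) ∧
      AsympNormal P
        (fun n ω => √(n : ℝ) * (downsideTVaR (empiricalCDF X n ω) p - downsideTVaR F p))
        ((1 / p ^ 2) *
          ∫ x in Iic (quantile F p), ∫ y in Iic (quantile F p), covKernel F x y)) ∧
    -- Lorenz curve
    (MemLp (fun x : ℝ => x) 2 ν → (∫ x, x ∂ν) ≠ 0 →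
      IntervalIntegrable (quantile F) volume 0 1 ∧
      (∀ t : ℝ, IntegrableOn (centredIndicator F t) (Iic (quantile F p))) ∧
      MemLp (lorenzInfluence F p) 2 ν ∧ (∫ t, lorenzInfluence F p t ∂ν) = 0 ∧
      IsLittleOP P (fun n ω =>
        √(n : ℝ) * (lorenzCurve (empiricalCDF X n ω) p - lorenzCurve F p)
          - (-(1 / √(n : ℝ)) * ∑ i ∈ Finset.range n, lorenzInfluence F p (X i ω))) ∧
      AsympNormal P
        (fun n ω => √(n : ℝ) * (lorenzCurve (empiricalCDF X n ω) p - lorenzCurve F p))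
        (∫ t, lorenzInfluence F p t ^ 2 ∂ν)) ∧
    -- Gini curve
    (MemLp (fun x : ℝ => x) 2 ν → (∫ x, x ∂ν) ≠ 0 → ContinuousAt (quantile F) (1 - p) →
      IntervalIntegrable (quantile F) volume 0 1 ∧
      (∀ t : ℝ, IntegrableOn (centredIndicator F t) (Iic (quantile F p)) ∧
        IntegrableOn (centredIndicator F t) (Iic (quantile F (1 - p)))) ∧
      MemLp (giniInfluence F p) 2 ν ∧ (∫ t, giniInfluence F p t ∂ν) = 0 ∧
      IsLittleOP P (fun n ω =>
        √(n : ℝ) * (giniCurve (empiricalCDF X n ω) p - giniCurve F p)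
          - (1 / √(n : ℝ)) * ∑ i ∈ Finset.range n,
              (lorenzInfluence F (1 - p) (X i ω) + lorenzInfluence F p (X i ω))) ∧
      AsympNormal P
        (fun n ω => √(n : ℝ) * (giniCurve (empiricalCDF X n ω) p - giniCurve F p))
        (∫ t, giniInfluence F p t ^ 2 ∂ν)) := by
  subst hF
  have hmean : (∫ x, x ∂ν) ≠ 0 → quantileMean (cdf ν) ≠ 0 := fun h => by rwa [quantileMean_cdf]
  refine ⟨fun hL => ?_, fun hL => ?_, fun hL hμ => ?_, fun hL hμ hcont' => ?_⟩
  · have hL' := memLp_max_sub hL (quantile (cdf ν) p)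
    obtain ⟨h1, h2⟩ := covKernel_upper ν _ hL'
    refine ⟨intervalIntegrable_quantile_upper ν hp (hL'.integrable one_le_two), h1, ?_⟩
    rw [h2]
    exact asympNormal_upsideTVaR hindep hlaw hp hcont hL'
  · have hL' := memLp_max_sub_rev hL (quantile (cdf ν) p)
    obtain ⟨h1, h2⟩ := covKernel_lower ν _ hL'
    refine ⟨intervalIntegrable_quantile_lower ν hp (hL'.integrable one_le_two), h1, ?_⟩
    rw [h2]
    exact asympNormal_downsideTVaR hindep hlaw hp hcont hL'
  · refine ⟨intervalIntegrable_quantile ν (hL.integrable one_le_two),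
      fun t => (integral_centredIndicator ν _ (memLp_shortfall hL _) t).1,
      memLp_lorenzInfluence hL, integral_lorenzInfluence hL, ?_,
      asympNormal_lorenzCurve hL hp hindep hlaw (hmean hμ) hcont⟩
    simpa only [scaledMean_lorenzInfluence hL, neg_mul, sub_neg_eq_add] using
      isLittleOP_lorenzCurve hL hp hindep hlaw (hmean hμ) hcont
  · refine ⟨intervalIntegrable_quantile ν (hL.integrable one_le_two),
      fun t => ⟨(integral_centredIndicator ν _ (memLp_shortfall hL _) t).1,
        (integral_centredIndicator ν _ (memLp_shortfall hL _) t).1⟩, ?_, ?_, ?_,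
      asympNormal_giniCurve hL hp hindep hlaw (hmean hμ) hcont hcont'⟩
    · rw [giniInfluence_cdf hL hp (hmean hμ)]
      exact (memLp_lorenzInfluence hL).add (memLp_lorenzInfluence hL)
    · rw [giniInfluence_cdf hL hp (hmean hμ),
        integral_add ((memLp_lorenzInfluence hL).integrable one_le_two)
          ((memLp_lorenzInfluence hL).integrable one_le_two), integral_lorenzInfluence hL,
        integral_lorenzInfluence hL, add_zero]
    · simpa only [scaledMean_lorenzInfluence hL, Finset.sum_add_distrib, mul_add] using
        isLittleOP_giniCurve hL hp hindep hlaw (hmean hμ) hcont hcont'
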